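/- **Setting.** An actuator has parameters $k_\tau\neq 0$, $N_m\neq 0$ and $J_m,B_m,B_l,M_r,B_r,K_r>0$. Its load is either a finite mass $M_l>0$ or a rigid contact ($M_l=\infty$). With $$P_m=\frac1{J_ms^2+B_ms},\qquad P_r=\frac1{M_rs^2+B_rs+K_r},\qquad P_l=\frac1{M_ls^2+B_ls}\quad(P_l=0\text{ if }M_l=\infty),$$ the plant from motor current to force is $$P_{i\to F}=-K_r\,\frac{k_\tau P_mP_r}{N_m\,(N_m^2P_m+P_l+P_r)} .$$ Write it in normal form with force $F=x_1$ and input $u$: $$\dot x_1=x_2,\qquad \dot x_2=\psi z+\phi^\top x+g\,u,\qquad \dot z=Sz+x_1,\qquad S=-B_l/M_l .$$ For $M_l=\infty$ there is no zero-dynamics state $z$. This rigid-contact plant is the nominal plant; its parameters are $\bar\phi,\bar g$, and it has $\dot x_1=x_2$, $\dot x_2=\bar\phi^\top x+\bar g u$. **Loop.** Let $r$ be an external reference, $d$ an input disturbance, and $u_r=r-k_pF-k_d\dot F$ the output of an outer proportional-derivative controller ($k_p=k_d=0$ is allowed). For $\tau>0$, the disturbance observer uses two second-order Butterworth filters $Q(s)=1/((\tau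 s)^2+\sqrt2\,\tau s+1)$ with states $\xi,\zeta\in\mathbb R^2$. With $$A=\begin{pmatrix}0&1\\-1&-\sqrt2\end{pmatrix},\qquad B=\begin{pmatrix}0\\1\end{pmatrix},\qquad C=(1\ \ 0),$$ the closed loop is the plant above with input $u=C(\zeta-\xi)+u_r+d$, together with $$\tau\dot\xi=A\xi+\tfrac{g}{\bar g}BC(\zeta-\xi)+\tfrac1{\bar g}B\big(\psi z+(\phi-\bar\phi)^\top x\big)+\tfrac g{\bar g}B(u_r+d),$$ $$\tau\dot\zeta=A\zeta+BC(\zeta-\xi)+Bu_r .$$ The nominal loop is the nominal plant with input $u=r-k_pF-k_d\dot F$, with no disturbance and no observer. **Theorem.** Assume that the outer controller stabilizes the nominal plant, that is, all roots of $s^2-\bar\phi_2s-\bar\phi_1+\bar g(k_p+k_ds)$ have negative real part (this holds for $k_p=k_d=0$, and whenever $\bar gk_p,\bar gk_d\ge0$). Let $M_{\min}>0$. Then: 1. (Robust stability.) There is $\tau^*>0$ such that for every $0<\tau<\tau^*$ and every load $M_l\in[M_{\min},\infty]$ the closed loop with $r=d=0$ is globally exponentially stable. 2. (Convergence to nominal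 performance.) For all $R,\varepsilon>0$ there is $\tau_\varepsilon>0$ such that the following holds for every $0<\tau<\tau_\varepsilon$, every load $M_l\in[M_{\min},\infty]$, all continuous $r,d:[0,\infty)\to[-R,R]$, and every closed-loop trajectory whose initial state has sup-norm at most $R$. If $\bar x$ is the trajectory of the nominal loop with the same $r$ and $\bar x(0)=x(0)$, then $\max(|F(t)-\bar x_1(t)|,|\dot F(t)-\bar x_2(t)|)\le\varepsilon$ for all $t\ge0$. -/

import Mathlib

open Matrix Filter Topology

noncomputable section

namespace DOB

/-- Physical parameters of the actuator: motor constant `kτ`, transmission constant `Nm`,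
motor inertia and damping `Jm`, `Bm`, load damping `Bl`, and mass, damping and stiffness
`Mr`, `Br`, `Kr` of the elastomer. The load mass is not part of the data. -/
structure Actuator where
  kτ : ℝ
  Nm : ℝ
  Jm : ℝ
  Bm : ℝ
  Bl : ℝ
  Mr : ℝ
  Br : ℝ
  Kr : ℝ
  kτ_ne : kτ ≠ 0
  Nm_ne : Nm ≠ 0
  Jm_pos : 0 < Jm
  Bm_pos : 0 < Bm
  Bl_pos : 0 < Bl
  Mr_pos : 0 < Mr
  Br_pos : 0 < Br
  Kr_pos : 0 < Kr

/-- The load seen by the actuator: a finite mass, or a rigid contact (infinite mass). -/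
inductive Load where
  | mass (Ml : ℝ)
  | rigid

/-- Loads whose mass lies in `[Mmin, ∞]`. -/
def Load.AtLeast (Mmin : ℝ) : Load → Prop
  | .mass Ml => Mmin ≤ Ml
  | .rigid => True

/-! ### Transfer functions -/

namespace Actuator

def motorTF (p : Actuator) (s : ℂ) : ℂ := 1 / (p.Jm * s ^ 2 + p.Bm * s)

def elastomerTF (p : Actuator) (s : ℂ) : ℂ := 1 / (p.Mr * s ^ 2 + p.Br * s + p.Kr)

/-- Load transfer function; an infinite load mass gives `0`. -/
def loadTF (p : Actuator) : Load → ℂ → ℂ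
  | .mass Ml, s => 1 / (Ml * s ^ 2 + p.Bl * s)
  | .rigid, _ => 0

/-- Transfer function from motor current to elastomer deflection. -/
def currentToDeflectionTF (p : Actuator) (L : Load) (s : ℂ) : ℂ :=
  -(p.kτ * p.motorTF s * p.elastomerTF s) /
    (p.Nm * (p.Nm ^ 2 * p.motorTF s + p.loadTF L s + p.elastomerTF s))

/-- Transfer function from motor current to actuator force. -/
def currentToForceTF (p : Actuator) (L : Load) (s : ℂ) : ℂ :=
  p.Kr * p.currentToDeflectionTF L s

end Actuator

/-- The rigid contact is the limit of an infinite load mass. -/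
theorem tendsto_currentToForceTF (p : Actuator) (s : ℂ) (hs : s ≠ 0)
    (h : (p.Nm : ℂ) ^ 2 * p.motorTF s + p.elastomerTF s ≠ 0) :
    Tendsto (fun Ml : ℝ => p.currentToForceTF (.mass Ml) s) atTop
      (𝓝 (p.currentToForceTF .rigid s)) := by
  have h1 : Tendsto (fun Ml : ℝ => p.loadTF (.mass Ml) s) atTop (𝓝 0) := by
    simp only [Actuator.loadTF, one_div]
    refine tendsto_inv₀_cobounded.comp ?_
    have h2 : Tendsto (fun Ml : ℝ => (Ml : ℂ)) atTop (Bornology.cobounded ℂ) := by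
      rw [← tendsto_norm_atTop_iff_cobounded]
      simpa using tendsto_abs_atTop_atTop
    have h3 := (tendsto_mul_right_cobounded (pow_ne_zero 2 hs)).comp h2
    exact (tendsto_add_const_cobounded (p.Bl * s)).comp h3
  have hN : (p.Nm : ℂ) ≠ 0 := by exact_mod_cast p.Nm_ne
  unfold Actuator.currentToForceTF Actuator.currentToDeflectionTF
  refine Tendsto.const_mul _ (Tendsto.div tendsto_const_nhds ?_ ?_)
  · refine Tendsto.const_mul _ ?_
    exact ((tendsto_const_nhds.add h1).add tendsto_const_nhds)
  · simpa [Actuator.loadTF] using ⟨p.Nm_ne, h⟩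

/-! ### State-space form of the plant -/

/-- A plant of relative degree two in normal form, with `m` zero-dynamics states:
`x₀' = x₁`, `x₁' = ψᵀ z + φᵀ x + g u`, `z' = S z + G x`, and output `x₀`. -/
structure NormalForm (m : ℕ) where
  φ : Fin 2 → ℝ
  ψ : Fin m → ℝ
  g : ℝ
  S : Matrix (Fin m) (Fin m) ℝ
  G : Matrix (Fin m) (Fin 2) ℝ

/-- Number of zero-dynamics states of the actuator plant under a given load. -/
def Load.zeroDim : Load → ℕ
  | .mass _ => 1
  | .rigid => 0

namespace Actuator

/-- Leading coefficient of the plant denominator (numerator normalized to `s + Bl / Ml`). -/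
def lead (p : Actuator) (Ml : ℝ) : ℝ :=
  p.Nm ^ 2 * p.Mr + p.Jm + p.Jm * p.Mr / Ml

/-- Coefficients `c₁`, `c₀` in the division
`(Jm s + Bm)(Mr s² + Br s + Kr) = (s + β)(Jm Mr s² + c₁ s + c₀) + (Bm Kr - β c₀)`. -/
def c₁ (p : Actuator) (β : ℝ) : ℝ := p.Jm * p.Br + p.Bm * p.Mr - β * (p.Jm * p.Mr)

def c₀ (p : Actuator) (β : ℝ) : ℝ := p.Jm * p.Kr + p.Bm * p.Br - β * p.c₁ β

/-- Normal form of the plant from motor current to actuator force. -/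
def plant (p : Actuator) : (L : Load) → NormalForm L.zeroDim
  | .mass Ml =>
    let a := p.lead Ml
    let β := p.Bl / Ml
    { φ := ![-(p.Nm ^ 2 * p.Kr + p.c₀ β / Ml) / a,
             -(p.Nm ^ 2 * p.Br + p.Bm + p.c₁ β / Ml) / a]
      ψ := fun _ => -((p.Bm * p.Kr - β * p.c₀ β) / Ml) / a
      g := -(p.Kr * p.kτ / p.Nm) / a
      S := fun _ _ => -β
      G := fun _ => ![1, 0] }
  | .rigid =>
    let a := p.Nm ^ 2 * p.Mr + p.Jm
    { φ := ![-(p.Nm ^ 2 * p.Kr) / a, -(p.Nm ^ 2 * p.Br + p.Bm) / a]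
      ψ := fun i => i.elim0
      g := -(p.Kr * p.kτ / p.Nm) / a
      S := fun i => i.elim0
      G := fun i => i.elim0 }

/-- The nominal plant: infinite load mass. -/
abbrev nominal (p : Actuator) : NormalForm Load.rigid.zeroDim := p.plant .rigid

end Actuator

/-- `(x, z, u)` is a Laplace-domain solution of the normal form at the complex frequency `s`. -/
def NormalForm.LaplaceSolution {m : ℕ} (P : NormalForm m) (s : ℂ)
    (x : Fin 2 → ℂ) (z : Fin m → ℂ) (u : ℂ) : Prop :=
  s * x 0 = x 1 ∧
  s * x 1 = (∑ i, (P.ψ i : ℂ) * z i) + (∑ j, (P.φ j : ℂ) * x j) + P.g * u ∧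
  ∀ i, s * z i = (∑ k, (P.S i k : ℂ) * z k) + ∑ j, (P.G i j : ℂ) * x j

/-- The normal form `p.plant L` realizes the transfer function from current to force. -/
theorem plant_realizes (p : Actuator) (L : Load) (hL : ∀ Ml, L = .mass Ml → 0 < Ml)
    (s : ℂ) (hm : (p.Jm : ℂ) * s ^ 2 + p.Bm * s ≠ 0)
    (hr : (p.Mr : ℂ) * s ^ 2 + p.Br * s + p.Kr ≠ 0)
    (hl : ∀ Ml : ℝ, L = .mass Ml → (Ml : ℂ) * s ^ 2 + p.Bl * s ≠ 0)
    (hd : (p.Nm : ℂ) ^ 2 * p.motorTF s + p.loadTF L s + p.elastomerTF s ≠ 0)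
    (x : Fin 2 → ℂ) (z : Fin L.zeroDim → ℂ) (u : ℂ)
    (h : (p.plant L).LaplaceSolution s x z u) :
    x 0 = p.currentToForceTF L s * u := by
  have hN : (p.Nm : ℂ) ≠ 0 := by exact_mod_cast p.Nm_ne
  obtain ⟨h0, h1, h2⟩ := h
  unfold Actuator.currentToForceTF Actuator.currentToDeflectionTF
  rw [← mul_div_assoc, div_mul_eq_mul_div, eq_div_iff (mul_ne_zero hN hd)]
  cases L with
  | rigid =>
    have ha : (p.Nm : ℂ) ^ 2 * p.Mr + p.Jm ≠ 0 := by
      have : (0 : ℝ) < p.Nm ^ 2 * p.Mr + p.Jm := by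
        have := p.Mr_pos; have := p.Jm_pos; positivity
      exact_mod_cast this.ne'
    have e : (∑ i, ((p.plant .rigid).ψ i : ℂ) * z i) = 0 :=
      Finset.sum_eq_zero fun i _ => i.elim0
    rw [e] at h1
    simp only [Actuator.plant, Fin.sum_univ_two, Matrix.cons_val_zero, Matrix.cons_val_one] at h1
    rw [← h0] at h1
    push_cast at h1
    simp only [Actuator.motorTF, Actuator.elastomerTF, Actuator.loadTF]
    generalize (p.Nm : ℂ) = N at *
    generalize (p.Jm : ℂ) = J at *
    generalize (p.Bm : ℂ) = B at *
    generalize (p.Mr : ℂ) = Mr at *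
    generalize (p.Br : ℂ) = Br at *
    generalize (p.Kr : ℂ) = K at *
    generalize (p.kτ : ℂ) = k at *
    generalize x 0 = y at *
    have h3 : y * N * (N ^ 2 * (Mr * s ^ 2 + Br * s + K) + (J * s ^ 2 + B * s)) = -(K * k * u) := by
      field_simp at h1
      linear_combination h1
    have e1 : N ^ 2 * (1 / (J * s ^ 2 + B * s)) + 0 + 1 / (Mr * s ^ 2 + Br * s + K)
        = (N ^ 2 * (Mr * s ^ 2 + Br * s + K) + (J * s ^ 2 + B * s))
          / ((J * s ^ 2 + B * s) * (Mr * s ^ 2 + Br * s + K)) := by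
      rw [add_zero, mul_one_div, div_add_div _ _ hm hr]; ring_nf
    rw [e1, mul_div_assoc', mul_div_assoc', div_eq_iff (mul_ne_zero hm hr)]
    calc _ = y * N * (N ^ 2 * (Mr * s ^ 2 + Br * s + K) + (J * s ^ 2 + B * s)) := by ring
      _ = -(K * k * u) := h3
      _ = _ := by
        generalize J * s ^ 2 + B * s = a at *
        generalize Mr * s ^ 2 + Br * s + K = b at *
        field_simp
  | mass Ml =>
    have hM := hL Ml rfl
    have hl := hl Ml rfl
    have hMc : (Ml : ℂ) ≠ 0 := by exact_mod_cast hM.ne'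
    have ha : (p.lead Ml : ℂ) ≠ 0 := by
      have : 0 < p.lead Ml := by
        have := p.Mr_pos; have := p.Jm_pos; unfold Actuator.lead; positivity
      exact_mod_cast this.ne'
    have hadef : (p.lead Ml : ℂ) * Ml = (p.Nm ^ 2 * p.Mr + p.Jm) * Ml + p.Jm * p.Mr := by
      unfold Actuator.lead; push_cast; field_simp
    have h2 := h2 (0 : Fin 1)
    change _ = (∑ i : Fin 1, _) + _ at h2
    change _ = (∑ i : Fin 1, _) + _ + _ at h1
    simp only [Actuator.plant, Fin.sum_univ_two, Fin.sum_univ_one, Matrix.cons_val_zero,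
      Matrix.cons_val_one] at h1 h2
    rw [← h0] at h1
    simp only [Actuator.c₀, Actuator.c₁] at h1
    push_cast at h1 h2
    simp only [Actuator.motorTF, Actuator.elastomerTF, Actuator.loadTF]
    generalize (p.lead Ml : ℂ) = a at *
    generalize (p.Nm : ℂ) = N at *
    generalize (p.Jm : ℂ) = J at *
    generalize (p.Bm : ℂ) = B at *
    generalize (p.Mr : ℂ) = Mr at *
    generalize (p.Br : ℂ) = Br at *
    generalize (p.Kr : ℂ) = K at *
    generalize (p.kτ : ℂ) = k at *
    generalize (p.Bl : ℂ) = Bl at *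
    generalize (Ml : ℂ) = M at *
    generalize x 0 = y at *
    generalize z (0 : Fin 1) = w at *
    have h3 : y * N * (N ^ 2 * (Mr * s ^ 2 + Br * s + K) * (M * s ^ 2 + Bl * s)
        + (J * s ^ 2 + B * s) * (Mr * s ^ 2 + Br * s + K)
        + (J * s ^ 2 + B * s) * (M * s ^ 2 + Bl * s))
        = -(K * k * u) * (M * s ^ 2 + Bl * s) := by
      obtain ⟨b, rfl⟩ : ∃ b, Bl = b * M := ⟨Bl / M, by field_simp⟩
      rw [mul_div_cancel_right₀ _ hMc] at h1 h2
      field_simp at h1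
      linear_combination (exp := 1) s * (s + b) * h1 - s * y * s * s * (s + b) * N * hadef
        - s * N * (B * K - b * (J * K + B * Br - b * (J * Br + B * Mr - b * (J * Mr)))) * h2
    have e1 : N ^ 2 * (1 / (J * s ^ 2 + B * s)) + 1 / (M * s ^ 2 + Bl * s)
          + 1 / (Mr * s ^ 2 + Br * s + K)
        = (N ^ 2 * (Mr * s ^ 2 + Br * s + K) * (M * s ^ 2 + Bl * s)
        + (J * s ^ 2 + B * s) * (Mr * s ^ 2 + Br * s + K)
        + (J * s ^ 2 + B * s) * (M * s ^ 2 + Bl * s))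
          / ((J * s ^ 2 + B * s) * (Mr * s ^ 2 + Br * s + K) * (M * s ^ 2 + Bl * s)) := by
      generalize J * s ^ 2 + B * s = a at *
      generalize Mr * s ^ 2 + Br * s + K = b at *
      generalize M * s ^ 2 + Bl * s = c at *
      field_simp
    rw [e1, mul_div_assoc', mul_div_assoc',
      div_eq_iff (mul_ne_zero (mul_ne_zero hm hr) hl)]
    rw [← mul_assoc, h3]
    generalize J * s ^ 2 + B * s = a at *
    generalize Mr * s ^ 2 + Br * s + K = b at *
    field_simp

/-! ### The loop with disturbance observer -/

/-- State matrices of the normalized second-order Butterworth filter. -/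
def filterA : Matrix (Fin 2) (Fin 2) ℝ := !![0, 1; -1, -√2]

def filterB : Fin 2 → ℝ := ![0, 1]

def filterC : Fin 2 → ℝ := ![1, 0]

/-- Second-order Butterworth low-pass filter with cut-off frequency `ωc`. -/
def butterworth (ωc : ℝ) (s : ℂ) : ℂ := 1 / ((s / ωc) ^ 2 + (√2 : ℝ) * (s / ωc) + 1)

/-- `τ ξ' = A ξ + B v` with output `C ξ` realizes the Butterworth filter with `ωc = 1 / τ`. -/
theorem filter_realizes (τ : ℝ) (s : ℂ) (v : ℂ) (ξ : Fin 2 → ℂ)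
    (hs : (s / (1 / τ : ℝ)) ^ 2 + (√2 : ℝ) * (s / (1 / τ : ℝ)) + 1 ≠ 0)
    (h : ∀ i, τ * s * ξ i = (∑ j, (filterA i j : ℂ) * ξ j) + filterB i * v) :
    ∑ j, (filterC j : ℂ) * ξ j = butterworth (1 / τ) s * v := by
  have h0 := h 0
  have h1 := h 1
  simp [filterA, filterB] at h0 h1
  unfold butterworth
  rw [div_mul_eq_mul_div, eq_div_iff hs]
  simp only [filterC, Fin.sum_univ_two, Matrix.cons_val_zero, Matrix.cons_val_one]
  push_cast
  simp only [one_div, div_inv_eq_mul]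
  rw [← h0] at h1
  linear_combination h1

/-- State `(x, z, z̄, ξ, ζ)` of the loop: plant, plant zero dynamics, zero dynamics of the
nominal model, and the two filters `Q_A`, `Q_B`. -/
abbrev LoopState (m n : ℕ) : Type :=
  (Fin 2 → ℝ) × (Fin m → ℝ) × (Fin n → ℝ) × (Fin 2 → ℝ) × (Fin 2 → ℝ)

/-- Output of the proportional-derivative controller in negative feedback from the force `x 0`
(whose derivative is `x 1`), added to the external signal `r`. -/
def reference (kp kd r : ℝ) (x : Fin 2 → ℝ) : ℝ := r - (kp * x 0 + kd * x 1)

/-- Right-hand side of the loop formed by the plant `P`, the disturbance observer with nominal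
model `N` and filter time scale `τ`, and the outer controller `(kp, kd)`, driven by the
external signal `r` and the input disturbance `d`. -/
def loopField {m n : ℕ} (P : NormalForm m) (N : NormalForm n) (τ kp kd r d : ℝ) :
    LoopState m n → LoopState m n
  | (x, z, zbar, ξ, ζ) =>
    let ur := reference kp kd r x
    ( ![x 1, P.ψ ⬝ᵥ z + P.φ ⬝ᵥ x + P.g * (filterC ⬝ᵥ (ζ - ξ)) + P.g * (ur + d)],
      P.S *ᵥ z + P.G *ᵥ x,
      N.S *ᵥ zbar + N.G *ᵥ x,
      τ⁻¹ • (filterA *ᵥ ξ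
        + (P.g / N.g * (filterC ⬝ᵥ (ζ - ξ))) • filterB
        + (1 / N.g * (-(N.ψ ⬝ᵥ zbar) + P.ψ ⬝ᵥ z + (P.φ - N.φ) ⬝ᵥ x)) • filterB
        + (P.g / N.g * (ur + d)) • filterB),
      τ⁻¹ • (filterA *ᵥ ζ + (filterC ⬝ᵥ (ζ - ξ)) • filterB + ur • filterB) )

/-- Right-hand side of the nominal loop: the undisturbed nominal plant, with the same outer
controller and no disturbance observer. -/
def nominalField {n : ℕ} (N : NormalForm n) (kp kd r : ℝ) :
    (Fin 2 → ℝ) × (Fin n → ℝ) → (Fin 2 → ℝ) × (Fin n → ℝ)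
  | (x, zbar) =>
    ( ![x 1, N.ψ ⬝ᵥ zbar + N.φ ⬝ᵥ x + N.g * reference kp kd r x],
      N.S *ᵥ zbar + N.G *ᵥ x )

/-- `X` solves `X' = f t X` on `[0, ∞)`. -/
def IsTrajectory {E : Type*} [NormedAddCommGroup E] [NormedSpace ℝ E]
    (f : ℝ → E → E) (X : ℝ → E) : Prop :=
  ∀ t, 0 ≤ t → HasDerivWithinAt X (f t (X t)) (Set.Ici 0) t

/-- Global exponential stability of the autonomous system `X' = f X`. -/
def ExponentiallyStable {E : Type*} [NormedAddCommGroup E] [NormedSpace ℝ E]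
    (f : E → E) : Prop :=
  ∃ K c : ℝ, 0 < K ∧ 0 < c ∧ ∀ X : ℝ → E, IsTrajectory (fun _ => f) X →
    ∀ t, 0 ≤ t → ‖X t‖ ≤ K * Real.exp (-c * t) * ‖X 0‖

/-- The outer controller stabilizes the nominal plant: the characteristic polynomial of the
nominal loop is Hurwitz. -/
def StabilizesNominal (p : Actuator) (kp kd : ℝ) : Prop :=
  ∀ s : ℂ, s ^ 2 - (p.nominal.φ 1 : ℂ) * s - (p.nominal.φ 0 : ℂ)
    + (p.nominal.g : ℂ) * (kp + kd * s) = 0 → s.re < 0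

/-- Negative feedback always stabilizes the nominal plant; so does no outer controller at all. -/
theorem stabilizesNominal_of_nonneg (p : Actuator) (kp kd : ℝ)
    (hp : 0 ≤ p.nominal.g * kp) (hd : 0 ≤ p.nominal.g * kd) : StabilizesNominal p kp kd := by
  have ha : 0 < p.Nm ^ 2 * p.Mr + p.Jm := by
    have := p.Mr_pos; have := p.Jm_pos; positivity
  have hN : 0 < p.Nm ^ 2 := by have := p.Nm_ne; positivity
  have h0 : p.nominal.φ 0 < 0 := by
    simp only [Actuator.nominal, Actuator.plant, Matrix.cons_val_zero]
    exact div_neg_of_neg_of_pos (neg_neg_of_pos (mul_pos hN p.Kr_pos)) ha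
  have h1 : p.nominal.φ 1 < 0 := by
    simp only [Actuator.nominal, Actuator.plant, Matrix.cons_val_one]
    exact div_neg_of_neg_of_pos
      (neg_neg_of_pos (add_pos (mul_pos hN p.Br_pos) p.Bm_pos)) ha
  intro s hs
  have hre := congrArg Complex.re hs
  have him := congrArg Complex.im hs
  simp [pow_two] at hre him
  by_contra! hneg
  have key : s.im * (2 * s.re + (p.nominal.g * kd - p.nominal.φ 1)) = 0 := by
    linear_combination him
  rcases mul_eq_zero.1 key with h | h
  · rw [h] at hre
    nlinarith [mul_nonneg hneg hd, mul_nonneg hneg hneg, mul_nonneg hneg (neg_nonneg.2 h1.le)]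
  · linarith

/-- Admissible external signals: continuous on `[0, ∞)` and bounded by `R`. -/
def AdmissibleSignal (R : ℝ) (v : ℝ → ℝ) : Prop :=
  ContinuousOn v (Set.Ici 0) ∧ ∀ t, 0 ≤ t → |v t| ≤ R

end DOB

end

/-! Put `η = ζ - ξ` and `ρ = g / ḡ`. Subtracting the filter equations gives a fast companion system
`τ η₀' = η₁`, `τ η₁' = -ρ η₀ - √2 η₁ + v`, whose input `v` is affine in the reference, the
disturbance, `x` and `ψᵀ z`. Since `ρ` stays in some `[ρ₁, 1]` with `ρ₁ > 0`, this system is stable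
uniformly over the loads.

The decisive point is an exact identity, not an asymptotic expansion: `y₁ = x₁ + ḡ τ (η₁ + √2 η₀)`
satisfies `y₁' = φ̄ᵀ x + ḡ u_r` (`IsTrajectory.hasDerivWithinAt_shifted`). Hence `(x₀, y₁)` obeys
the nominal loop up to a perturbation of size `τ |η|`. The fast system in turn is driven by the slow
states with a gain bounded independently of `τ`. The feedback loop has gain `O(τ)`, and a small-gain
argument (`exists_interconnection_bound`) closes it for small `τ`. Each subsystem is estimated by a
Lyapunov function whose constants do not depend on `τ` (`exists_companion_bound`).

Uniformity in the load is delicate because the zero dynamics have rate `β = B_l / M_l`, which tends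
to `0` as the mass grows. Their coupling `ψ` is also `O(1 / M_l)`, so the gain `|ψ| / β` remains
bounded (`exists_plant_bounds`).

All estimates carry a weight `exp (-c t)`. A rate `c > 0` gives exponential stability; `c = 0` gives
boundedness of `η` under bounded signals. In the latter case the difference from the nominal loop is
a stable companion system with inputs and initial error `O(τ)`, so it is `O(τ)` for all time. -/

namespace DOB

/-! ### Scalar comparison and first-order systems -/

/-- If `V' ≤ -l V + D` on `[0, T]`, then any `M ≥ V 0` with `D ≤ l M` bounds `V` there. -/
theorem le_of_deriv_le_neg_mul_add {V V' : ℝ → ℝ} {T l D M : ℝ}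
    (hV : ∀ t, 0 ≤ t → HasDerivWithinAt V (V' t) (Set.Ici 0) t)
    (hb : ∀ t ∈ Set.Icc 0 T, V' t ≤ -l * V t + D) (h0 : V 0 ≤ M) (hD : D ≤ l * M) :
    ∀ t ∈ Set.Icc 0 T, V t ≤ M := by
  have hW : ∀ t, 0 ≤ t → HasDerivWithinAt (fun t => Real.exp (l * t) * (V t - M))
      (Real.exp (l * t) * l * (V t - M) + Real.exp (l * t) * V' t) (Set.Ici 0) t := by
    intro t ht
    have h1 : HasDerivWithinAt (fun t : ℝ => Real.exp (l * t)) (Real.exp (l * t) * l)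
        (Set.Ici 0) t := by
      simpa using (((hasDerivAt_id t).const_mul l).exp).hasDerivWithinAt
    exact h1.mul ((hV t ht).sub_const M)
  have hanti : AntitoneOn (fun t => Real.exp (l * t) * (V t - M)) (Set.Icc 0 T) := by
    refine antitoneOn_of_hasDerivWithinAt_nonpos (convex_Icc 0 T)
      (fun t ht => ((hW t ht.1).mono Set.Icc_subset_Ici_self).continuousWithinAt)
      (fun t ht => (hW t (interior_subset ht).1).mono
        (interior_subset.trans Set.Icc_subset_Ici_self)) ?_
    intro t ht
    have hE := Real.exp_pos (l * t)
    have := hb t (interior_subset ht)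
    have : l * (V t - M) + V' t ≤ 0 := by linarith
    calc _ = Real.exp (l * t) * (l * (V t - M) + V' t) := by ring
      _ ≤ 0 := mul_nonpos_of_nonneg_of_nonpos hE.le this
  intro t ht
  have h := hanti ⟨le_rfl, ht.1.trans ht.2⟩ ht ht.1
  simp only [mul_zero, Real.exp_zero, one_mul] at h
  have hE := Real.exp_pos (l * t)
  by_contra! hlt
  have : 0 < Real.exp (l * t) * (V t - M) := mul_pos hE (by linarith)
  linarith

/-- The weight `exp (c t)` turns a decay estimate for `V` into a uniform bound, at the price of
lowering its decay rate by `c`. -/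
theorem hasDerivWithinAt_exp_mul {V : ℝ → ℝ} {V' c t : ℝ} {s : Set ℝ}
    (h : HasDerivWithinAt V V' s t) :
    HasDerivWithinAt (fun t => Real.exp (c * t) * V t)
      (Real.exp (c * t) * (c * V t + V')) s t := by
  have h1 : HasDerivWithinAt (fun t : ℝ => Real.exp (c * t)) (Real.exp (c * t) * c) s t := by
    simpa using (((hasDerivAt_id t).const_mul c).exp).hasDerivWithinAt
  refine (h1.mul h).congr_deriv ?_
  ring

/-- A stable first-order system driven by an exponentially decaying input. -/
theorem firstOrder_bound {w x : ℝ → ℝ} {β κ c T W X : ℝ} (hβ : 0 < β) (hc : c ≤ β / 2)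
    (hw : ∀ t, 0 ≤ t → HasDerivWithinAt w (-β * w t + κ * x t) (Set.Ici 0) t)
    (h0 : |w 0| ≤ W) (hX : 0 ≤ X)
    (hx : ∀ t ∈ Set.Icc 0 T, |x t| ≤ X * Real.exp (-c * t)) :
    ∀ t ∈ Set.Icc 0 T, |w t| ≤ (W + 2 * (|κ| / β) * X) * Real.exp (-c * t) := by
  have hW : 0 ≤ W := (abs_nonneg _).trans h0
  -- The weighted equation keeps the rate `β - c ≥ β / 2`, which is the origin of the factor 2 in
  -- the gain.
  have hD : |κ| * X ≤ (β - c) * (W + 2 * (|κ| / β) * X) := by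
    have h1 : β / 2 ≤ β - c := by linarith
    have h2 : 0 ≤ 2 * (|κ| / β) * X := by positivity
    calc |κ| * X = β / 2 * (2 * (|κ| / β) * X) := by field_simp
      _ ≤ (β - c) * (W + 2 * (|κ| / β) * X) := by gcongr <;> linarith
  have h2 : 0 ≤ 2 * (|κ| / β) * X := by positivity
  have hin : ∀ t ∈ Set.Icc 0 T, |Real.exp (c * t) * (κ * x t)| ≤ |κ| * X := by
    intro t ht
    rw [abs_mul, abs_mul, Real.abs_exp]
    calc _ ≤ Real.exp (c * t) * (|κ| * (X * Real.exp (-c * t))) := by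
          gcongr; exact hx t ht
      _ = |κ| * X * (Real.exp (c * t) * Real.exp (-c * t)) := by ring
      _ = _ := by rw [← Real.exp_add]; simp
  have hup := le_of_deriv_le_neg_mul_add (T := T) (l := β - c) (D := |κ| * X)
    (fun t ht => hasDerivWithinAt_exp_mul (c := c) (hw t ht))
    (fun t ht => by
      have := (abs_le.1 (hin t ht)).2
      linarith) (M := W + 2 * (|κ| / β) * X)
    (by simp; linarith [le_abs_self (w 0)]) hD
  have hlo := le_of_deriv_le_neg_mul_add (T := T) (l := β - c) (D := |κ| * X)
    (fun t ht => (hasDerivWithinAt_exp_mul (c := c) (hw t ht)).neg)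
    (fun t ht => by
      have := (abs_le.1 (hin t ht)).1
      simp only [Pi.neg_apply]
      linarith) (M := W + 2 * (|κ| / β) * X)
    (by simp; linarith [neg_abs_le (w 0)]) hD
  intro t ht
  have h1 := hup t ht
  have h3 := hlo t ht
  simp only [Pi.neg_apply] at h3
  have h4 : |Real.exp (c * t) * w t| ≤ W + 2 * (|κ| / β) * X := abs_le.2 ⟨by linarith, h1⟩
  rw [abs_mul, Real.abs_exp] at h4
  have h5 : Real.exp (c * t) * Real.exp (-c * t) = 1 := by rw [← Real.exp_add]; simp
  calc |w t| = Real.exp (c * t) * |w t| * Real.exp (-c * t) := by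
        rw [mul_right_comm, h5, one_mul]
    _ ≤ _ := by gcongr

/-! ### Second-order companion systems -/

/-- Dissipation inequality for the companion system. -/
theorem companion_dissipation {a a₁ a₂ b u v f h : ℝ} (ha₁ : 0 < a₁) (h1 : a₁ ≤ a)
    (h2 : a ≤ a₂) (hb : 0 < b) {k : ℝ} (hk : 0 < k) (hk1 : k ≤ 2 * a₁ * b) (hk2 : k ≤ 2 * b) :
    2 * (b * u + v) * (b * (v + f) + (-a * u - b * v + h)) + 2 * v * (-a * u - b * v + h)
        + 4 * a * u * (v + f)
      ≤ -(k / 2 / (2 * b ^ 2 + 2 * a₂ + 3)) * ((b * u + v) ^ 2 + v ^ 2 + 2 * a * u ^ 2)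
        + (4 * b ^ 2 + 16 + (2 * b ^ 2 + 4 * a₂) ^ 2) / k * (f ^ 2 + h ^ 2) := by
  have hM : 0 < 2 * b ^ 2 + 2 * a₂ + 3 := by nlinarith [sq_nonneg b]
  have ha : 0 < a := ha₁.trans_le h1
  have hV : (b * u + v) ^ 2 + v ^ 2 + 2 * a * u ^ 2
      ≤ (2 * b ^ 2 + 2 * a₂ + 3) * (u ^ 2 + v ^ 2) := by
    nlinarith [sq_nonneg (b * u - v), mul_nonneg (sub_nonneg.2 h2) (sq_nonneg u), sq_nonneg u,
      mul_nonneg (sq_nonneg b) (sq_nonneg v), mul_nonneg (ha.le.trans h2) (sq_nonneg v),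
      sq_nonneg v]
  have hV' : k / 2 / (2 * b ^ 2 + 2 * a₂ + 3) * ((b * u + v) ^ 2 + v ^ 2 + 2 * a * u ^ 2)
      ≤ k / 2 * (u ^ 2 + v ^ 2) := by
    rw [div_mul_eq_mul_div, div_le_iff₀ hM]
    calc _ ≤ k / 2 * ((2 * b ^ 2 + 2 * a₂ + 3) * (u ^ 2 + v ^ 2)) := by gcongr
      _ = _ := by ring
  -- Four cross terms couple the state to the inputs, two with `u` and two with `v`. Each is charged
  -- `k / 4`, so half of the dissipation `k (u² + v²)` survives.
  have young : ∀ m x y : ℝ, m * x * y ≤ k / 4 * x ^ 2 + m ^ 2 / k * y ^ 2 := by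
    intro m x y
    have : 0 ≤ (k / 2 * x - m * y) ^ 2 / k := by positivity
    have e : (k / 2 * x - m * y) ^ 2 / k
        = k / 4 * x ^ 2 + m ^ 2 / k * y ^ 2 - m * x * y := by field_simp; ring
    linarith
  have y1 := young (2 * b) u h
  have y2 := young 4 v h
  have y3 := young (2 * b ^ 2 + 4 * a) u f
  have y4 := young (2 * b) v f
  have hsq : (2 * b ^ 2 + 4 * a) ^ 2 / k * f ^ 2 ≤ (2 * b ^ 2 + 4 * a₂) ^ 2 / k * f ^ 2 := by
    gcongr
  have hu : k * u ^ 2 ≤ 2 * a * b * u ^ 2 := by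
    have : a₁ * b ≤ a * b := by gcongr
    gcongr; linarith
  have hv : k * v ^ 2 ≤ 2 * b * v ^ 2 := by gcongr
  have hC : (2 * b) ^ 2 / k * h ^ 2 + 4 ^ 2 / k * h ^ 2
      + ((2 * b ^ 2 + 4 * a₂) ^ 2 / k * f ^ 2 + (2 * b) ^ 2 / k * f ^ 2)
      ≤ (4 * b ^ 2 + 16 + (2 * b ^ 2 + 4 * a₂) ^ 2) / k * (f ^ 2 + h ^ 2) := by
    have e : (4 * b ^ 2 + 16 + (2 * b ^ 2 + 4 * a₂) ^ 2) / k * (f ^ 2 + h ^ 2)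
      = (2 * b) ^ 2 / k * h ^ 2 + 4 ^ 2 / k * h ^ 2
      + ((2 * b ^ 2 + 4 * a₂) ^ 2 / k * f ^ 2 + (2 * b) ^ 2 / k * f ^ 2)
      + (16 / k * f ^ 2 + (2 * b ^ 2 + 4 * a₂) ^ 2 / k * h ^ 2) := by ring
    have : 0 ≤ 16 / k * f ^ 2 + (2 * b ^ 2 + 4 * a₂) ^ 2 / k * h ^ 2 := by positivity
    linarith
  -- The Lyapunov function `(b u + v)² + v² + 2 a u²` is chosen so that all `u v` terms cancel in
  -- its derivative.
  have e : 2 * (b * u + v) * (b * (v + f) + (-a * u - b * v + h))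
        + 2 * v * (-a * u - b * v + h) + 4 * a * u * (v + f)
      = -(2 * a * b * u ^ 2) - 2 * b * v ^ 2 + 2 * b * u * h + 4 * v * h
        + (2 * b ^ 2 + 4 * a) * u * f + 2 * b * v * f := by ring
  linarith

/-- A stable companion system with time scale `τ`, driven by exponentially decaying inputs;
the bound is uniform over `τ ≤ 1`, the stiffness `a ∈ [a₁, a₂]` and the rate `c ≤ c₀`. -/
theorem exists_companion_bound (a₁ a₂ b : ℝ) (ha₁ : 0 < a₁) (ha₂ : a₁ ≤ a₂) (hb : 0 < b) :
    ∃ K c₀ : ℝ, 0 < K ∧ 0 < c₀ ∧ ∀ a τ c T U F : ℝ, a₁ ≤ a → a ≤ a₂ → 0 < τ → τ ≤ 1 →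
      0 ≤ c → c ≤ c₀ → 0 ≤ U → 0 ≤ F → ∀ u v f h : ℝ → ℝ,
      (∀ t, 0 ≤ t → HasDerivWithinAt u (τ⁻¹ * (v t + f t)) (Set.Ici 0) t) →
      (∀ t, 0 ≤ t → HasDerivWithinAt v (τ⁻¹ * (-a * u t - b * v t + h t)) (Set.Ici 0) t) →
      |u 0| ≤ U → |v 0| ≤ U →
      (∀ t ∈ Set.Icc 0 T, |f t| ≤ F * Real.exp (-c * t)) →
      (∀ t ∈ Set.Icc 0 T, |h t| ≤ F * Real.exp (-c * t)) →
      ∀ t ∈ Set.Icc 0 T, |u t| ≤ K * (U + F) * Real.exp (-c * t) ∧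
        |v t| ≤ K * (U + F) * Real.exp (-c * t) := by
  obtain ⟨k, hk, hk1, hk2⟩ : ∃ k : ℝ, 0 < k ∧ k ≤ 2 * a₁ * b ∧ k ≤ 2 * b :=
    ⟨min (2 * a₁ * b) (2 * b), by positivity, min_le_left _ _, min_le_right _ _⟩
  obtain ⟨m, hm, hm1, hm2⟩ : ∃ m : ℝ, 0 < m ∧ m ≤ 1 ∧ m ≤ 2 * a₁ :=
    ⟨min 1 (2 * a₁), by positivity, min_le_left _ _, min_le_right _ _⟩
  have ha₂' : 0 < a₂ := ha₁.trans_le ha₂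
  set Mx : ℝ := 2 * b ^ 2 + 2 * a₂ + 3 with hMx
  have hMpos : 0 < Mx := by positivity
  set l : ℝ := k / 2 / Mx with hl
  have hlpos : 0 < l := by positivity
  set C : ℝ := (4 * b ^ 2 + 16 + (2 * b ^ 2 + 4 * a₂) ^ 2) / k with hCdef
  have hCpos : 0 < C := by positivity
  set K2 : ℝ := (2 * Mx + 4 * C / l) / m with hK2
  have hK2pos : 0 < K2 := by positivity
  -- The square root appears because the Lyapunov function is quadratic; `m x²` with `x = u` or `x =
  -- v` lies below it.
  refine ⟨√K2, l / 4, Real.sqrt_pos.2 hK2pos, by positivity, ?_⟩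
  intro a τ c T U F h1 h2 hτ hτ1 hc hc0 hU hF u v f h hu hv hu0 hv0 hf hh
  have ha : 0 < a := ha₁.trans_le h1
  have hVd : ∀ t, 0 ≤ t → HasDerivWithinAt
      (fun t => (b * u t + v t) ^ 2 + v t ^ 2 + 2 * a * u t ^ 2)
      (τ⁻¹ * (2 * (b * u t + v t) * (b * (v t + f t) + (-a * u t - b * v t + h t))
        + 2 * v t * (-a * u t - b * v t + h t) + 4 * a * u t * (v t + f t))) (Set.Ici 0) t := by
    intro t ht
    have hu' := hu t ht
    have hv' := hv t ht
    refine ((((hu'.const_mul b).add hv').pow 2).add (hv'.pow 2) |>.add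
      ((hu'.pow 2).const_mul (2 * a))).congr_deriv ?_
    simp only [Pi.add_apply]
    push_cast
    ring
  -- Dissipation and forcing both scale like `1 / τ`, so their ratio, and with it the bound, is free
  -- of `τ`. Half of the rate `l / τ` pays for the weight: `2 c ≤ l / 2 ≤ l / (2 τ)` since `τ ≤ 1`.
  have key := le_of_deriv_le_neg_mul_add (T := T) (l := l / (2 * τ)) (D := 2 * C * F ^ 2 / τ)
    (M := m * K2 * (U + F) ^ 2)
    (fun t ht => hasDerivWithinAt_exp_mul (c := 2 * c) (hVd t ht)) ?_ ?_ ?_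
  · have hsq : ∀ t ∈ Set.Icc 0 T, ∀ x : ℝ,
        m * x ^ 2 ≤ (b * u t + v t) ^ 2 + v t ^ 2 + 2 * a * u t ^ 2 →
        |x| ≤ √K2 * (U + F) * Real.exp (-c * t) := by
      intro t ht x hx
      refine abs_le_of_sq_le_sq ?_ (by positivity)
      have hE : Real.exp (2 * c * t) * Real.exp (-c * t) ^ 2 = 1 := by
        rw [pow_two, ← Real.exp_add, ← Real.exp_add]; ring_nf; simp
      have h3 := key t ht
      have h4 : Real.exp (2 * c * t) * (m * x ^ 2) ≤ m * K2 * (U + F) ^ 2 :=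
        (mul_le_mul_of_nonneg_left hx (Real.exp_pos _).le).trans h3
      have h5 : Real.exp (2 * c * t) * x ^ 2 ≤ K2 * (U + F) ^ 2 := by
        refine le_of_mul_le_mul_left ?_ hm
        linarith
      rw [mul_pow, mul_pow, Real.sq_sqrt hK2pos.le]
      calc x ^ 2 = Real.exp (2 * c * t) * x ^ 2 * Real.exp (-c * t) ^ 2 := by
            rw [mul_right_comm, hE, one_mul]
        _ ≤ _ := by gcongr
    intro t ht
    refine ⟨hsq t ht _ ?_, hsq t ht _ ?_⟩
    · have : m * u t ^ 2 ≤ 2 * a * u t ^ 2 := by gcongr; linarith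
      nlinarith [sq_nonneg (b * u t + v t), sq_nonneg (v t)]
    · have : m * v t ^ 2 ≤ 1 * v t ^ 2 := by gcongr
      have : 0 ≤ 2 * a * u t ^ 2 := by positivity
      nlinarith [sq_nonneg (b * u t + v t)]
  · intro t ht
    have hdis := companion_dissipation (u := u t) (v := v t) (f := f t) (h := h t)
      ha₁ h1 h2 hb hk hk1 hk2
    rw [← hMx, ← hl, ← hCdef] at hdis
    set V : ℝ := (b * u t + v t) ^ 2 + v t ^ 2 + 2 * a * u t ^ 2 with hVdef
    have hV0 : 0 ≤ V := by positivity
    have hE := Real.exp_pos (2 * c * t)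
    have hEE : Real.exp (2 * c * t) * Real.exp (-c * t) ^ 2 = 1 := by
      rw [pow_two, ← Real.exp_add, ← Real.exp_add]; ring_nf; simp
    have hfh : Real.exp (2 * c * t) * (f t ^ 2 + h t ^ 2) ≤ 2 * F ^ 2 := by
      have h3 : f t ^ 2 ≤ (F * Real.exp (-c * t)) ^ 2 := sq_le_sq.2 (by
        rw [abs_of_nonneg (by positivity : 0 ≤ F * Real.exp (-c * t))]; exact hf t ht)
      have h4 : h t ^ 2 ≤ (F * Real.exp (-c * t)) ^ 2 := sq_le_sq.2 (by
        rw [abs_of_nonneg (by positivity : 0 ≤ F * Real.exp (-c * t))]; exact hh t ht)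
      calc _ ≤ Real.exp (2 * c * t) * ((F * Real.exp (-c * t)) ^ 2
              + (F * Real.exp (-c * t)) ^ 2) := by gcongr
        _ = 2 * F ^ 2 * (Real.exp (2 * c * t) * Real.exp (-c * t) ^ 2) := by ring
        _ = _ := by rw [hEE, mul_one]
    have hrate : 2 * c ≤ l / (2 * τ) := by
      have : l / 2 ≤ l / (2 * τ) := by gcongr; linarith
      linarith
    calc _ ≤ Real.exp (2 * c * t) * (l / (2 * τ) * V
            + τ⁻¹ * (-l * V + C * (f t ^ 2 + h t ^ 2))) := by gcongr
      _ = -(l / (2 * τ)) * (Real.exp (2 * c * t) * V)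
            + C / τ * (Real.exp (2 * c * t) * (f t ^ 2 + h t ^ 2)) := by field_simp; ring
      _ ≤ -(l / (2 * τ)) * (Real.exp (2 * c * t) * V) + C / τ * (2 * F ^ 2) := by gcongr
      _ = _ := by ring
  · have e : m * K2 = 2 * Mx + 4 * C / l := by rw [hK2]; field_simp
    have h3 : u 0 ^ 2 ≤ U ^ 2 := sq_le_sq.2 (by rwa [abs_of_nonneg hU])
    have h4 : v 0 ^ 2 ≤ U ^ 2 := sq_le_sq.2 (by rwa [abs_of_nonneg hU])
    have h5 : (b * u 0 + v 0) ^ 2 + v 0 ^ 2 + 2 * a * u 0 ^ 2 ≤ Mx * (u 0 ^ 2 + v 0 ^ 2) := by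
      rw [hMx]
      nlinarith [sq_nonneg (b * u 0 - v 0), mul_nonneg (sub_nonneg.2 h2) (sq_nonneg (u 0)),
        sq_nonneg (u 0), mul_nonneg (sq_nonneg b) (sq_nonneg (v 0)),
        mul_nonneg ha₂'.le (sq_nonneg (v 0)), sq_nonneg (v 0)]
    rw [e]
    simp only [mul_zero, Real.exp_zero, one_mul]
    calc _ ≤ Mx * (U ^ 2 + U ^ 2) := h5.trans (by gcongr)
      _ = (2 * Mx) * U ^ 2 := by ring
      _ ≤ (2 * Mx + 4 * C / l) * (U + F) ^ 2 := by
        gcongr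
        · have : 0 ≤ 4 * C / l := by positivity
          linarith
        · linarith
  · have e : m * K2 = 2 * Mx + 4 * C / l := by rw [hK2]; field_simp
    rw [e]
    calc 2 * C * F ^ 2 / τ = l / (2 * τ) * (4 * C / l * F ^ 2) := by field_simp; ring
      _ ≤ _ := by
        gcongr
        · linarith
        · linarith

/-! ### Small-gain estimate -/

theorem sqrt_two_le_two : √(2 : ℝ) ≤ 2 := by
  rw [Real.sqrt_le_left (by norm_num)]; norm_num

/-- Controls the combination `η₁ + √2 η₀` by which the velocity coordinate is shifted. -/
theorem abs_add_sqrt_two_mul_le {x y S : ℝ} (hx : |x| ≤ S) (hy : |y| ≤ S) :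
    |y + √2 * x| ≤ 3 * S := by
  have hs := sqrt_two_le_two
  calc |y + √2 * x| ≤ |y| + √2 * |x| := by
        refine (abs_add_le _ _).trans_eq ?_
        rw [abs_mul, abs_of_nonneg (Real.sqrt_nonneg 2)]
    _ ≤ S + 2 * S := by gcongr
    _ = 3 * S := by ring

/-- Small-gain estimate for the interconnection of a slow companion system `y`, first-order
zero dynamics `w` and a fast companion system `η` with time scale `τ`. -/
theorem exists_interconnection_bound (a b G H D ρ₁ : ℝ) (ha : 0 < a) (hb : 0 < b)
    (hH : 0 ≤ H) (hD : 0 ≤ D) (hρ₁ : 0 < ρ₁) (hρ₁' : ρ₁ ≤ 1) :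
    ∃ Γ τ₀ c₀ : ℝ, 0 < Γ ∧ 0 < τ₀ ∧ τ₀ ≤ 1 ∧ 0 < c₀ ∧ ∀ τ ρ β κ c U : ℝ, 0 < τ → τ < τ₀ →
      ρ₁ ≤ ρ → ρ ≤ 1 → 0 < β → |κ| ≤ D * β → 0 ≤ c → c ≤ c₀ → c ≤ β / 2 → 0 ≤ U →
      ∀ y₀ y₁ w η₀ η₁ q v : ℝ → ℝ,
      (∀ t, 0 ≤ t → HasDerivWithinAt y₀ (y₁ t - G * τ * (η₁ t + √2 * η₀ t)) (Set.Ici 0) t) →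
      (∀ t, 0 ≤ t → HasDerivWithinAt y₁
        (-a * y₀ t - b * y₁ t + (b * (G * τ * (η₁ t + √2 * η₀ t)) + q t)) (Set.Ici 0) t) →
      (∀ t, 0 ≤ t → HasDerivWithinAt w (-β * w t + κ * y₀ t) (Set.Ici 0) t) →
      (∀ t, 0 ≤ t → HasDerivWithinAt η₀ (τ⁻¹ * η₁ t) (Set.Ici 0) t) →
      (∀ t, 0 ≤ t → HasDerivWithinAt η₁ (τ⁻¹ * (-ρ * η₀ t - √2 * η₁ t + v t)) (Set.Ici 0) t) →
      |y₀ 0| ≤ U → |y₁ 0| ≤ U → |w 0| ≤ U → |η₀ 0| ≤ U → |η₁ 0| ≤ U →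
      (∀ t, 0 ≤ t → |q t| ≤ U * Real.exp (-c * t)) →
      (∀ t, 0 ≤ t → |v t| ≤ H * (|y₀ t| + |y₁ t| + |w t| + τ * (|η₀ t| + |η₁ t|)
        + U * Real.exp (-c * t))) →
      ∀ t, 0 ≤ t → |y₀ t| ≤ Γ * U * Real.exp (-c * t) ∧ |y₁ t| ≤ Γ * U * Real.exp (-c * t) ∧
        |η₀ t| ≤ Γ * U * Real.exp (-c * t) ∧ |η₁ t| ≤ Γ * U * Real.exp (-c * t) := by
  obtain ⟨Ky, cy, hKy, hcy, hy⟩ := exists_companion_bound a a b ha le_rfl hb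
  obtain ⟨Ke, ce, hKe, hce, he⟩ := exists_companion_bound ρ₁ 1 √2 hρ₁ hρ₁' (by positivity)
  -- Going once around the loop yields `S ≤ A U + B τ S` for the weighted supremum `S` of the fast
  -- state. The bound on `τ` makes `B τ ≤ 1 / 2`.
  set A : ℝ := Ke * (1 + 2 * H + H * (2 + 2 * D) * (2 * Ky)) with hA
  set B : ℝ := Ke * (H * (2 + 2 * D) * (Ky * (3 * (1 + b) * |G|)) + 2 * H) with hB
  have hA0 : 0 < A := by positivity
  have hB0 : 0 ≤ B := by positivity
  refine ⟨2 * A + Ky * (2 + 3 * (1 + b) * |G| * (2 * A)), min 1 (1 / (2 * B + 1)), min cy ce,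
    by positivity, by positivity, min_le_left _ _, by positivity, ?_⟩
  intro τ ρ β κ c U hτ hττ hρ hρ' hβ hκ hc hcc hcβ hU y₀ y₁ w η₀ η₁ q v
    dy₀ dy₁ dw dη₀ dη₁ iy₀ iy₁ iw iη₀ iη₁ hq hv T hT
  have hτ1 : τ ≤ 1 := hττ.le.trans (min_le_left _ _)
  have hBτ : B * τ ≤ 1 / 2 := by
    have : τ ≤ 1 / (2 * B + 1) := hττ.le.trans (min_le_right _ _)
    rw [le_div_iff₀ (by positivity)] at this
    nlinarith
  -- Working on `[0, T]` makes the supremum finite, so it can be absorbed, and attained, so the fast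
  -- estimate can be evaluated at `ts`. The resulting bound does not depend on `T`.
  obtain ⟨ts, hts, hmax⟩ := isCompact_Icc.exists_isMaxOn (Set.nonempty_Icc.2 hT)
    (f := fun t => Real.exp (c * t) * max |η₀ t| |η₁ t|) (by
      have h0 : ContinuousOn η₀ (Set.Icc 0 T) := fun t ht =>
        (dη₀ t ht.1).continuousWithinAt.mono Set.Icc_subset_Ici_self
      have h1 : ContinuousOn η₁ (Set.Icc 0 T) := fun t ht =>
        (dη₁ t ht.1).continuousWithinAt.mono Set.Icc_subset_Ici_self
      exact (by fun_prop : Continuous fun t => Real.exp (c * t)).continuousOn.mul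
        (h0.abs.sup h1.abs))
  set S : ℝ := Real.exp (c * ts) * max |η₀ ts| |η₁ ts| with hS
  have hS0 : 0 ≤ S := mul_nonneg (Real.exp_pos _).le ((abs_nonneg _).trans (le_max_left _ _))
  have hexp : ∀ t, Real.exp (c * t) * Real.exp (-c * t) = 1 := fun t => by
    rw [← Real.exp_add]; simp
  have hη : ∀ t ∈ Set.Icc 0 T, max |η₀ t| |η₁ t| ≤ S * Real.exp (-c * t) := by
    intro t ht
    calc max |η₀ t| |η₁ t|
        = Real.exp (c * t) * max |η₀ t| |η₁ t| * Real.exp (-c * t) := by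
          rw [mul_right_comm, hexp, one_mul]
      _ ≤ _ := by gcongr; exact hmax ht
  have hp : ∀ t ∈ Set.Icc 0 T,
      |G * τ * (η₁ t + √2 * η₀ t)| ≤ 3 * |G| * τ * S * Real.exp (-c * t) := by
    intro t ht
    have := abs_add_sqrt_two_mul_le ((le_max_left _ _).trans (hη t ht))
      ((le_max_right _ _).trans (hη t ht))
    rw [abs_mul, abs_mul, abs_of_pos hτ]
    calc _ ≤ |G| * τ * (3 * (S * Real.exp (-c * t))) := by gcongr
      _ = _ := by ring
  set Fy : ℝ := 3 * (1 + b) * |G| * τ * S + U with hFy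
  set Y : ℝ := Ky * (U + Fy) with hY
  have hY0 : 0 ≤ Y := by positivity
  have hyb : ∀ t ∈ Set.Icc 0 T, |y₀ t| ≤ Y * Real.exp (-c * t) ∧
      |y₁ t| ≤ Y * Real.exp (-c * t) := by
    refine hy a 1 c T U Fy le_rfl le_rfl one_pos le_rfl hc (hcc.trans (min_le_left _ _)) hU
      (by positivity) y₀ y₁ (fun t => -(G * τ * (η₁ t + √2 * η₀ t)))
      (fun t => b * (G * τ * (η₁ t + √2 * η₀ t)) + q t)
      (fun t ht => (dy₀ t ht).congr_deriv (by ring))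
      (fun t ht => (dy₁ t ht).congr_deriv (by ring)) iy₀ iy₁ ?_ ?_
    · intro t ht
      rw [abs_neg]
      refine (hp t ht).trans ?_
      gcongr
      have : 0 ≤ 3 * b * |G| * τ * S + U := by positivity
      rw [hFy]; linarith
    · intro t ht
      have h1 := hp t ht
      have h2 := hq t ht.1
      have h3 : 0 ≤ 3 * |G| * τ * S * Real.exp (-c * t) := by positivity
      calc _ ≤ b * |G * τ * (η₁ t + √2 * η₀ t)| + |q t| := by
            refine (abs_add_le _ _).trans_eq ?_
            rw [abs_mul, abs_of_pos hb]
        _ ≤ b * (3 * |G| * τ * S * Real.exp (-c * t)) + U * Real.exp (-c * t) := by gcongr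
        _ ≤ _ := by rw [hFy]; linarith
  have hwb : ∀ t ∈ Set.Icc 0 T, |w t| ≤ (U + 2 * D * Y) * Real.exp (-c * t) := by
    intro t ht
    refine (firstOrder_bound hβ hcβ dw iw hY0 (fun t ht => (hyb t ht).1) t ht).trans ?_
    have : |κ| / β ≤ D := (div_le_iff₀ hβ).2 hκ
    gcongr
  set Fv : ℝ := H * ((2 + 2 * D) * Y + 2 * U + 2 * τ * S) with hFv
  have hηb := he ρ τ c T U Fv hρ hρ' hτ hτ1 hc (hcc.trans (min_le_right _ _)) hU
    (by positivity) η₀ η₁ (fun _ => 0) v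
    (fun t ht => (dη₀ t ht).congr_deriv (by ring)) dη₁ iη₀ iη₁
    (fun t _ => by simp only [abs_zero]; positivity) (by
      intro t ht
      refine (hv t ht.1).trans ?_
      rw [hFv, mul_assoc]
      gcongr
      have h1 := hyb t ht
      have h2 := hwb t ht
      have h3 := mul_le_mul_of_nonneg_left ((le_max_left _ _).trans (hη t ht)) hτ.le
      have h4 := mul_le_mul_of_nonneg_left ((le_max_right _ _).trans (hη t ht)) hτ.le
      linarith [h1.1, h1.2])
  have hSle : S ≤ 2 * A * U := by
    have h1 : max |η₀ ts| |η₁ ts| ≤ Ke * (U + Fv) * Real.exp (-c * ts) :=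
      max_le (hηb ts hts).1 (hηb ts hts).2
    have h2 : S ≤ Ke * (U + Fv) := by
      calc S ≤ Real.exp (c * ts) * (Ke * (U + Fv) * Real.exp (-c * ts)) := by
            rw [hS]; gcongr
        _ = Ke * (U + Fv) * (Real.exp (c * ts) * Real.exp (-c * ts)) := by ring
        _ = _ := by rw [hexp, mul_one]
    have h3 : Ke * (U + Fv) = A * U + B * τ * S := by
      rw [hFv, hY, hFy, hA, hB]; ring
    have h4 : B * τ * S ≤ 1 / 2 * S := by gcongr
    linarith
  have hTT : T ∈ Set.Icc 0 T := ⟨hT, le_rfl⟩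
  have hYle : Y ≤ Ky * (2 + 3 * (1 + b) * |G| * (2 * A)) * U := by
    have h1 : τ * S ≤ 1 * (2 * A * U) := by gcongr
    have h2 : 3 * (1 + b) * |G| * (τ * S) ≤ 3 * (1 + b) * |G| * (1 * (2 * A * U)) := by gcongr
    calc Y = Ky * (2 * U + 3 * (1 + b) * |G| * (τ * S)) := by rw [hY, hFy]; ring
      _ ≤ Ky * (2 * U + 3 * (1 + b) * |G| * (1 * (2 * A * U))) := by gcongr
      _ = _ := by ring
  have hYΓ : Y ≤ (2 * A + Ky * (2 + 3 * (1 + b) * |G| * (2 * A))) * U := by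
    have : 0 ≤ 2 * A * U := by positivity
    linarith
  have hSΓ : S ≤ (2 * A + Ky * (2 + 3 * (1 + b) * |G| * (2 * A))) * U := by
    have : 0 ≤ Ky * (2 + 3 * (1 + b) * |G| * (2 * A)) * U := by positivity
    linarith
  refine ⟨(hyb T hTT).1.trans ?_, (hyb T hTT).2.trans ?_,
    ((le_max_left _ _).trans (hη T hTT)).trans ?_,
    ((le_max_right _ _).trans (hη T hTT)).trans ?_⟩ <;> gcongr

/-! ### Hurwitz coefficients and load-uniform plant bounds -/

/-- Positivity of the coefficients of a real monic quadratic Hurwitz polynomial. -/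
theorem coeff_pos_of_hurwitz {a b : ℝ} (h : ∀ s : ℂ, s ^ 2 + b * s + a = 0 → s.re < 0) :
    0 < a ∧ 0 < b := by
  rcases le_or_gt 0 (b ^ 2 - 4 * a) with hd | hd
  · have hsq := Real.sq_sqrt hd
    -- The larger real root is negative, so `√(b² - 4a) < b`; this forces both signs.
    have h1 := h (((-b + √(b ^ 2 - 4 * a)) / 2 : ℝ) : ℂ) (by
      norm_cast; linear_combination hsq / 4)
    rw [Complex.ofReal_re] at h1
    have h0 := Real.sqrt_nonneg (b ^ 2 - 4 * a)
    have hb : 0 < b := by linarith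
    refine ⟨?_, hb⟩
    nlinarith
  · have hd' : 0 ≤ 4 * a - b ^ 2 := by linarith
    have hsq : √(4 * a - b * b) ^ 2 = 4 * a - b * b := Real.sq_sqrt (by linarith)
    have h1 := h ⟨-b / 2, √(4 * a - b ^ 2) / 2⟩ (by
      apply Complex.ext <;> simp [pow_two]
      · linear_combination -hsq / 4
      · ring)
    simp only at h1
    exact ⟨by nlinarith [sq_nonneg b], by linarith⟩

/-- These are the stiffness and the damping of the nominal loop in companion form, as the Lyapunov
estimate needs them. -/
theorem StabilizesNominal.coeff_pos {p : Actuator} {kp kd : ℝ} (h : StabilizesNominal p kp kd) :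
    0 < -p.nominal.φ 0 + p.nominal.g * kp ∧ 0 < -p.nominal.φ 1 + p.nominal.g * kd := by
  refine coeff_pos_of_hurwitz fun s hs => h s ?_
  push_cast at hs
  linear_combination hs

/-- Bounds on the plant parameters that are uniform over the loads with mass in `[Mmin, ∞]`. -/
theorem exists_plant_bounds (p : Actuator) {Mmin : ℝ} (hM : 0 < Mmin) :
    ∃ ρ₁ D : ℝ, 0 < ρ₁ ∧ ρ₁ ≤ 1 ∧ 0 ≤ D ∧ ∀ L : Load, L.AtLeast Mmin →
      ρ₁ ≤ (p.plant L).g / p.nominal.g ∧ (p.plant L).g / p.nominal.g ≤ 1 ∧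
      |(p.plant L).φ 0 - p.nominal.φ 0| ≤ D ∧ |(p.plant L).φ 1 - p.nominal.φ 1| ≤ D ∧
      (∀ z, |(p.plant L).ψ ⬝ᵥ z| ≤ D * ‖z‖) ∧
      ∃ β : ℝ, 0 < β ∧ |∑ i, (p.plant L).ψ i| ≤ D * β ∧
        ∀ z x i, ((p.plant L).S *ᵥ z + (p.plant L).G *ᵥ x) i = -β * z i + x 0 := by
  have hJ := p.Jm_pos
  have hMr := p.Mr_pos
  have hBl := p.Bl_pos
  set a₀ : ℝ := p.Nm ^ 2 * p.Mr + p.Jm with ha₀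
  have ha₀pos : 0 < a₀ := by positivity
  -- With `μ = 1 / Ml` the loads form the compact interval `[0, 1 / Mmin]`, the rigid contact being
  -- `μ = 0`. The plant coefficients are polynomials in `μ` over `a μ > 0`, hence bounded.
  set a : ℝ → ℝ := fun μ => a₀ + p.Jm * p.Mr * μ with ha
  have hapos : ∀ μ ∈ Set.Icc 0 (1 / Mmin), 0 < a μ := fun μ hμ => by
    have := hμ.1
    simp only [ha]; positivity
  have hane : ∀ μ ∈ Set.Icc 0 (1 / Mmin), a μ ≠ 0 := fun μ hμ => (hapos μ hμ).ne'
  have hac : ContinuousOn a (Set.Icc 0 (1 / Mmin)) := by fun_prop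
  have hbd : ∀ f : ℝ → ℝ, Continuous f → ∃ C, ∀ μ ∈ Set.Icc 0 (1 / Mmin), |f μ / a μ| ≤ C := by
    intro f hf
    obtain ⟨C, hC⟩ := isCompact_Icc.exists_bound_of_continuousOn
      (hf.continuousOn.div hac hane)
    exact ⟨C, fun μ hμ => hC μ hμ⟩
  obtain ⟨C₀, hC₀⟩ := hbd (fun μ => -(p.Nm ^ 2 * p.Kr + p.c₀ (p.Bl * μ) * μ))
    (by unfold Actuator.c₀ Actuator.c₁; fun_prop)
  obtain ⟨C₁, hC₁⟩ := hbd (fun μ => -(p.Nm ^ 2 * p.Br + p.Bm + p.c₁ (p.Bl * μ) * μ))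
    (by unfold Actuator.c₁; fun_prop)
  obtain ⟨C₂, hC₂⟩ := hbd (fun μ => -((p.Bm * p.Kr - p.Bl * μ * p.c₀ (p.Bl * μ)) * μ))
    (by unfold Actuator.c₀ Actuator.c₁; fun_prop)
  -- This is `ψ` stripped of its factor `μ`; since `β = Bl μ`, it bounds `|ψ| / β` even as `β → 0`.
  obtain ⟨C₃, hC₃⟩ := hbd (fun μ => -(p.Bm * p.Kr - p.Bl * μ * p.c₀ (p.Bl * μ)))
    (by unfold Actuator.c₀ Actuator.c₁; fun_prop)
  have h0mem : (0 : ℝ) ∈ Set.Icc 0 (1 / Mmin) := ⟨le_rfl, by positivity⟩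
  have hN₀ : |p.nominal.φ 0| ≤ C₀ := by simpa [Actuator.plant, ha] using hC₀ 0 h0mem
  have hN₁ : |p.nominal.φ 1| ≤ C₁ := by simpa [Actuator.plant, ha] using hC₁ 0 h0mem
  have hC₀' : 0 ≤ C₀ := (abs_nonneg _).trans hN₀
  have hC₁' : 0 ≤ C₁ := (abs_nonneg _).trans hN₁
  have hC₂' : 0 ≤ C₂ := (abs_nonneg _).trans (hC₂ 0 h0mem)
  have hC₃' : 0 ≤ C₃ := (abs_nonneg _).trans (hC₃ 0 h0mem)
  have hk : p.Kr * p.kτ / p.Nm ≠ 0 := div_ne_zero (mul_ne_zero p.Kr_pos.ne' p.kτ_ne) p.Nm_ne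
  have ha1 : a₀ ≤ a (1 / Mmin) := by
    simp only [ha]
    have : 0 ≤ p.Jm * p.Mr * (1 / Mmin) := by positivity
    linarith
  have ha1pos : 0 < a (1 / Mmin) := ha₀pos.trans_le ha1
  refine ⟨a₀ / a (1 / Mmin), 2 * C₀ + 2 * C₁ + C₂ + C₃ / p.Bl, by positivity,
    (div_le_one ha1pos).2 ha1, by positivity, ?_⟩
  have hC₃'' : 0 ≤ C₃ / p.Bl := by positivity
  intro L hL
  cases L with
  | rigid =>
    have : IsEmpty (Fin Load.rigid.zeroDim) := Fin.isEmpty'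
    have hg : p.nominal.g ≠ 0 := div_ne_zero (neg_ne_zero.2 hk) ha₀pos.ne'
    refine ⟨?_, ?_, ?_, ?_, ?_, 1, one_pos, ?_, fun _ _ i => isEmptyElim i⟩
    · rw [div_self hg]; exact (div_le_one ha1pos).2 ha1
    · rw [div_self hg]
    · rw [sub_self, abs_zero]; positivity
    · rw [sub_self, abs_zero]; positivity
    · intro z
      rw [dotProduct, Finset.univ_eq_empty, Finset.sum_empty, abs_zero]; positivity
    · rw [Finset.univ_eq_empty, Finset.sum_empty, abs_zero]; positivity
  | mass Ml =>
    have hMl : Mmin ≤ Ml := hL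
    have hMl0 : 0 < Ml := hM.trans_le hMl
    have hμ : 1 / Ml ∈ Set.Icc 0 (1 / Mmin) :=
      ⟨by positivity, one_div_le_one_div_of_le hM hMl⟩
    have hlead : p.lead Ml = a (1 / Ml) := by
      simp only [ha, Actuator.lead, ha₀]; ring
    have hap := hapos _ hμ
    have hratio : (p.plant (.mass Ml)).g / p.nominal.g = a₀ / a (1 / Ml) := by
      have hK := p.Kr_pos
      have hk := p.kτ_ne
      have hN := p.Nm_ne
      simp only [Actuator.plant, hlead, ← ha₀]
      field_simp
    have hβ : p.Bl * (1 / Ml) = p.Bl / Ml := mul_one_div _ _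
    have hφ₀ : |(p.plant (.mass Ml)).φ 0| ≤ C₀ := by
      have := hC₀ _ hμ
      simpa [Actuator.plant, hlead, hβ, div_eq_mul_inv] using this
    have hφ₁ : |(p.plant (.mass Ml)).φ 1| ≤ C₁ := by
      have := hC₁ _ hμ
      simpa [Actuator.plant, hlead, hβ, div_eq_mul_inv] using this
    set ψ : ℝ := -((p.Bm * p.Kr - p.Bl / Ml * p.c₀ (p.Bl / Ml)) / Ml) / p.lead Ml with hψ
    have hψC₂ : |ψ| ≤ C₂ := by
      have := hC₂ _ hμ
      simp only [hβ, mul_one_div] at this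
      rwa [hψ, hlead]
    have hψC₃ : |ψ| ≤ C₃ / p.Bl * (p.Bl / Ml) := by
      have h1 := hC₃ _ hμ
      simp only [hβ] at h1
      have e : ψ = -(p.Bm * p.Kr - p.Bl / Ml * p.c₀ (p.Bl / Ml)) / a (1 / Ml) * (1 / Ml) := by
        rw [hψ, hlead]; ring
      rw [e, abs_mul, abs_of_pos (by positivity : (0 : ℝ) < 1 / Ml)]
      calc _ ≤ C₃ * (1 / Ml) := by gcongr
        _ = _ := by field_simp
    refine ⟨?_, ?_, ?_, ?_, ?_, p.Bl / Ml, by positivity, ?_, ?_⟩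
    · rw [hratio]
      have := hμ.2
      gcongr
      simp only [ha]; gcongr
    · rw [hratio, div_le_one hap]
      simp only [ha]
      have : 0 ≤ p.Jm * p.Mr * (1 / Ml) := by positivity
      linarith
    · exact (abs_sub _ _).trans (by linarith)
    · exact (abs_sub _ _).trans (by linarith)
    · intro z
      change |∑ i : Fin 1, ψ * z i| ≤ _
      rw [Fin.sum_univ_one, abs_mul]
      have h1 : |z (0 : Fin 1)| ≤ ‖z‖ := norm_le_pi_norm z (0 : Fin 1)
      gcongr
      linarith
    · change |∑ i : Fin 1, ψ| ≤ _
      rw [Fin.sum_univ_one]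
      refine hψC₃.trans ?_
      gcongr
      linarith
    · intro z x i
      change (∑ j : Fin 1, -(p.Bl / Ml) * z j) + (∑ j : Fin 2, (![1, 0] : Fin 2 → ℝ) j * x j) = _
      have hi : i = (0 : Fin 1) := Subsingleton.elim (α := Fin 1) _ _
      subst hi
      simp

/-! ### Coordinates of the loop -/

section Components

variable {m : ℕ} {P : NormalForm m} {N : NormalForm 0} {τ kp kd : ℝ} {r d : ℝ → ℝ}
  {X : ℝ → LoopState m 0}

/-- Coordinates of a trajectory of the loop; the filter states enter through `ζ - ξ` and `ζ`. -/
theorem IsTrajectory.loop_coordinates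
    (hX : IsTrajectory (fun t => loopField P N τ kp kd (r t) (d t)) X) {t : ℝ} (ht : 0 ≤ t) :
    HasDerivWithinAt (fun t => (X t).1 0) ((X t).1 1) (Set.Ici 0) t ∧
    HasDerivWithinAt (fun t => (X t).1 1)
      (P.ψ ⬝ᵥ (X t).2.1 + (P.φ 0 * (X t).1 0 + P.φ 1 * (X t).1 1)
        + P.g * ((X t).2.2.2.2 0 - (X t).2.2.2.1 0)
        + P.g * (r t - (kp * (X t).1 0 + kd * (X t).1 1) + d t)) (Set.Ici 0) t ∧
    (∀ i, HasDerivWithinAt (fun t => (X t).2.1 i)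
      ((P.S *ᵥ (X t).2.1 + P.G *ᵥ (X t).1) i) (Set.Ici 0) t) ∧
    HasDerivWithinAt (fun t => (X t).2.2.2.2 0 - (X t).2.2.2.1 0)
      (τ⁻¹ * ((X t).2.2.2.2 1 - (X t).2.2.2.1 1)) (Set.Ici 0) t ∧
    HasDerivWithinAt (fun t => (X t).2.2.2.2 1 - (X t).2.2.2.1 1)
      (τ⁻¹ * (-(P.g / N.g) * ((X t).2.2.2.2 0 - (X t).2.2.2.1 0)
        - √2 * ((X t).2.2.2.2 1 - (X t).2.2.2.1 1)
        + ((1 - P.g / N.g) * (r t - (kp * (X t).1 0 + kd * (X t).1 1)) - P.g / N.g * d t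
          - 1 / N.g * (P.ψ ⬝ᵥ (X t).2.1 + (P.φ 0 - N.φ 0) * (X t).1 0
            + (P.φ 1 - N.φ 1) * (X t).1 1)))) (Set.Ici 0) t ∧
    HasDerivWithinAt (fun t => (X t).2.2.2.2 0) (τ⁻¹ * (X t).2.2.2.2 1) (Set.Ici 0) t ∧
    HasDerivWithinAt (fun t => (X t).2.2.2.2 1)
      (τ⁻¹ * (-(X t).2.2.2.2 0 - √2 * (X t).2.2.2.2 1
        + (((X t).2.2.2.2 0 - (X t).2.2.2.1 0)
          + (r t - (kp * (X t).1 0 + kd * (X t).1 1))))) (Set.Ici 0) t := by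
  have h := hX t ht
  simp only [loopField] at h
  have hx := hasDerivWithinAt_pi.1 h.fst
  have hz := hasDerivWithinAt_pi.1 h.snd.fst
  have hξ := hasDerivWithinAt_pi.1 h.snd.snd.snd.fst
  have hζ := hasDerivWithinAt_pi.1 h.snd.snd.snd.snd
  have hNψ : N.ψ ⬝ᵥ (X t).2.2.1 = 0 := by simp [dotProduct]
  refine ⟨hx 0, (hx 1).congr_deriv ?_, hz, ((hζ 0).sub (hξ 0)).congr_deriv ?_,
    ((hζ 1).sub (hξ 1)).congr_deriv ?_, (hζ 0).congr_deriv ?_, (hζ 1).congr_deriv ?_⟩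
  · simp [filterC, reference, dotProduct, Fin.sum_univ_two]
  · simp [filterA, filterB, filterC, reference, dotProduct, Fin.sum_univ_two]
    ring
  · rw [hNψ]
    simp [filterA, filterB, filterC, reference, vec2_dotProduct, vecHead, vecTail]
    ring
  · simp [filterA, filterB, vecHead, vecTail]
  · simp [filterA, filterB, filterC, reference, vecHead, vecTail, -mul_eq_mul_left_iff]
    ring

/-- In the shifted coordinate `x₁ + ḡ τ (η₁ + √2 η₀)`, with `η = ζ - ξ`, the plant follows the
nominal dynamics exactly: neither the disturbance nor the zero dynamics enter. -/
theorem IsTrajectory.hasDerivWithinAt_shifted (hτ : 0 < τ) (hN : N.g ≠ 0)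
    (hX : IsTrajectory (fun t => loopField P N τ kp kd (r t) (d t)) X) {t : ℝ} (ht : 0 ≤ t) :
    HasDerivWithinAt (fun t => (X t).1 1 + N.g * τ * (((X t).2.2.2.2 1 - (X t).2.2.2.1 1)
        + √2 * ((X t).2.2.2.2 0 - (X t).2.2.2.1 0)))
      (N.φ 0 * (X t).1 0 + N.φ 1 * (X t).1 1
        + N.g * (r t - (kp * (X t).1 0 + kd * (X t).1 1))) (Set.Ici 0) t := by
  obtain ⟨-, h1, -, h2, h3, -, -⟩ := hX.loop_coordinates ht
  refine (h1.add ((h3.add (h2.const_mul √2)).const_mul (N.g * τ))).congr_deriv ?_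
  field_simp
  ring

end Components

/-! ### Uniform bounds for the loop -/

theorem nominal_g_ne_zero (p : Actuator) : p.nominal.g ≠ 0 := by
  have h1 := p.Mr_pos
  have h2 := p.Jm_pos
  have h3 : p.Nm ^ 2 * p.Mr + p.Jm ≠ 0 := by positivity
  exact div_ne_zero (neg_ne_zero.2
    (div_ne_zero (mul_ne_zero p.Kr_pos.ne' p.kτ_ne) p.Nm_ne)) h3

/-- The fast input of the loop in terms of the slow states. -/
theorem abs_fast_input_le {ρ kp kd g D r d x₀ x₁ w φ₀ φ₁ : ℝ} (h0 : 0 ≤ ρ) (h1 : ρ ≤ 1)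
    (hφ₀ : |φ₀| ≤ D) (hφ₁ : |φ₁| ≤ D) :
    |(1 - ρ) * (r - (kp * x₀ + kd * x₁)) - ρ * d - 1 / g * (w + φ₀ * x₀ + φ₁ * x₁)|
      ≤ (1 + |kp| + |kd| + |1 / g| * (1 + D)) * (|r| + |d| + |x₀| + |x₁| + |w|) := by
  have hD : 0 ≤ D := (abs_nonneg _).trans hφ₀
  have e1 : |r - (kp * x₀ + kd * x₁)| ≤ |r| + (|kp| * |x₀| + |kd| * |x₁|) := by
    rw [← abs_mul, ← abs_mul]
    exact (abs_sub _ _).trans (add_le_add_right (abs_add_le _ _) _)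
  have e2 : |w + φ₀ * x₀ + φ₁ * x₁| ≤ |w| + D * |x₀| + D * |x₁| := by
    refine (abs_add_three _ _ _).trans ?_
    rw [abs_mul, abs_mul]
    gcongr
  calc _ ≤ |(1 - ρ) * (r - (kp * x₀ + kd * x₁))| + |ρ * d|
        + |1 / g * (w + φ₀ * x₀ + φ₁ * x₁)| :=
        (abs_sub _ _).trans (add_le_add_left (abs_sub _ _) _)
    _ = (1 - ρ) * |r - (kp * x₀ + kd * x₁)| + ρ * |d|
        + |1 / g| * |w + φ₀ * x₀ + φ₁ * x₁| := by
        rw [abs_mul, abs_mul, abs_mul, abs_of_nonneg h0, abs_of_nonneg (by linarith : 0 ≤ 1 - ρ)]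
    _ ≤ 1 * (|r| + (|kp| * |x₀| + |kd| * |x₁|)) + 1 * |d|
        + |1 / g| * (|w| + D * |x₀| + D * |x₁|) := by gcongr; linarith
    _ ≤ _ := by
        have t1 : 0 ≤ (|kp| + |kd| + |1 / g| * (1 + D)) * (|r| + |d|) := by positivity
        have t2 : 0 ≤ (1 + |kd| + |1 / g|) * |x₀| := by positivity
        have t3 : 0 ≤ (1 + |kp| + |1 / g|) * |x₁| := by positivity
        have t4 : 0 ≤ (1 + |kp| + |kd| + |1 / g| * D) * |w| := by positivity
        linarith

/-- Bounds on the loop that are uniform over the load and the filter time scale. -/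
theorem exists_loop_bound (p : Actuator) {kp kd : ℝ} (hC : StabilizesNominal p kp kd)
    {Mmin : ℝ} (hM : 0 < Mmin) :
    ∃ Γ τ₀ c₀ : ℝ, 0 < Γ ∧ 0 < τ₀ ∧ τ₀ ≤ 1 ∧ 0 < c₀ ∧ ∀ L : Load, L.AtLeast Mmin →
      ∃ β : ℝ, 0 < β ∧
        (∀ z x i, ((p.plant L).S *ᵥ z + (p.plant L).G *ᵥ x) i = -β * z i + x 0) ∧
        ∀ τ c U : ℝ, 0 < τ → τ < τ₀ → 0 ≤ c → c ≤ c₀ → c ≤ β / 2 →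
        ∀ r d : ℝ → ℝ, (∀ t, 0 ≤ t → |r t| ≤ U * Real.exp (-c * t)) →
        (∀ t, 0 ≤ t → |d t| ≤ U * Real.exp (-c * t)) →
        ∀ X : ℝ → LoopState L.zeroDim Load.rigid.zeroDim,
        IsTrajectory (fun t => loopField (p.plant L) p.nominal τ kp kd (r t) (d t)) X →
        ‖X 0‖ ≤ U → ∀ t, 0 ≤ t →
          |(X t).1 0| ≤ Γ * U * Real.exp (-c * t) ∧ |(X t).1 1| ≤ Γ * U * Real.exp (-c * t) ∧
          |(X t).2.2.2.2 0 - (X t).2.2.2.1 0| ≤ Γ * U * Real.exp (-c * t) ∧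
          |(X t).2.2.2.2 1 - (X t).2.2.2.1 1| ≤ Γ * U * Real.exp (-c * t) := by
  obtain ⟨ρ₁, D, hρ₁, hρ₁', hD, hplant⟩ := exists_plant_bounds p hM
  obtain ⟨ha, hb⟩ := hC.coeff_pos
  have hg := nominal_g_ne_zero p
  set G : ℝ := p.nominal.g with hG
  set E : ℝ := 1 + |kp| + |kd| + |1 / G| * (1 + D) with hE
  have hE0 : 0 ≤ E := by positivity
  obtain ⟨Γ, τ₀, c₀, hΓ, hτ₀, hτ₀1, hc₀, H⟩ := exists_interconnection_bound _ _ G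
    (E * (2 + 2 * |G|)) D ρ₁ ha hb (by positivity) hD hρ₁ hρ₁'
  -- `V U` dominates all data in the new coordinates: `(1 + 6|G|) U` for the shifted velocity, `2 U`
  -- for `η`, `D U` for `ψᵀ z`, `|G| U` for the input, and `2 U` for `|r| + |d|`.
  set V : ℝ := 3 + 6 * |G| + D with hV
  refine ⟨(1 + 3 * |G|) * (Γ * V), τ₀, c₀, by positivity, hτ₀, hτ₀1, hc₀, fun L hL => ?_⟩
  obtain ⟨hρ, hρ', hφ₀, hφ₁, hψ, β, hβ, hκ, hz⟩ := hplant L hL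
  refine ⟨β, hβ, hz, ?_⟩
  intro τ c U hτ hττ hc hcc hcβ r d hr hd X hX hX0
  have hτ1 : τ ≤ 1 := hττ.le.trans hτ₀1
  have hU : 0 ≤ U := (norm_nonneg _).trans hX0
  have n1 : ‖(X 0).1‖ ≤ U := (norm_fst_le _).trans hX0
  have n2 : ‖(X 0).2‖ ≤ U := (norm_snd_le _).trans hX0
  have n3 : ‖(X 0).2.1‖ ≤ U := (norm_fst_le _).trans n2
  have n4 : ‖(X 0).2.2.2‖ ≤ U := (norm_snd_le _).trans ((norm_snd_le _).trans n2)
  have n5 : ∀ i, |(X 0).1 i| ≤ U := fun i => (norm_le_pi_norm _ i).trans n1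
  have n6 : ∀ i, |(X 0).2.2.2.2 i - (X 0).2.2.2.1 i| ≤ 2 * U := fun i => by
    have h1 : |(X 0).2.2.2.2 i| ≤ U := (norm_le_pi_norm _ i).trans ((norm_snd_le _).trans n4)
    have h2 : |(X 0).2.2.2.1 i| ≤ U := (norm_le_pi_norm _ i).trans ((norm_fst_le _).trans n4)
    exact (abs_sub _ _).trans (by linarith)
  have hUV : 3 * U ≤ V * U := by gcongr; rw [hV]; linarith [abs_nonneg G]
  have hGU : |G| * U ≤ V * U := by gcongr; rw [hV]; linarith [abs_nonneg G]
  have hDU : D * U ≤ V * U := by gcongr; rw [hV]; linarith [abs_nonneg G]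
  have hC' := fun t (ht : 0 ≤ t) => hX.loop_coordinates (N := p.nominal) ht
  have key := H τ _ β (∑ i, (p.plant L).ψ i) c (V * U) hτ hττ hρ hρ' hβ hκ hc hcc hcβ
    (by positivity)
    (fun t => (X t).1 0)
    (fun t => (X t).1 1 + G * τ * (((X t).2.2.2.2 1 - (X t).2.2.2.1 1)
        + √2 * ((X t).2.2.2.2 0 - (X t).2.2.2.1 0)))
    (fun t => (p.plant L).ψ ⬝ᵥ (X t).2.1)
    (fun t => (X t).2.2.2.2 0 - (X t).2.2.2.1 0)
    (fun t => (X t).2.2.2.2 1 - (X t).2.2.2.1 1)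
    (fun t => G * r t) _
    (fun t ht => (hC' t ht).1.congr_deriv (by ring))
    (fun t ht => (hX.hasDerivWithinAt_shifted (N := p.nominal) hτ hg ht).congr_deriv (by
      rw [← hG]; ring))
    (fun t ht => by
      have h := HasDerivWithinAt.fun_sum (u := Finset.univ)
        fun i _ => ((hC' t ht).2.2.1 i).const_mul ((p.plant L).ψ i)
      refine h.congr_deriv ?_
      simp only [hz, mul_add, Finset.sum_add_distrib, Finset.sum_mul, dotProduct,
        Finset.mul_sum]
      congr 1
      exact Finset.sum_congr rfl fun i _ => by ring)
    (fun t ht => (hC' t ht).2.2.2.1)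
    (fun t ht => (hC' t ht).2.2.2.2.1)
    (by linarith [n5 0]) ?_
    ((hψ _).trans ((mul_le_mul_of_nonneg_left n3 hD).trans hDU))
    (by linarith [n6 0]) (by linarith [n6 1]) ?_ ?_
  · intro t ht
    obtain ⟨k1, k2, k3, k4⟩ := key t ht
    have hp := abs_add_sqrt_two_mul_le k3 k4
    have e0 : 0 ≤ Γ * (V * U) * Real.exp (-c * t) := by positivity
    have hlift : Γ * (V * U) * Real.exp (-c * t)
        ≤ (1 + 3 * |G|) * (Γ * V) * U * Real.exp (-c * t) := by
      have : 0 ≤ 3 * |G| * (Γ * (V * U) * Real.exp (-c * t)) := by positivity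
      linarith
    refine ⟨k1.trans hlift, ?_, k3.trans hlift, k4.trans hlift⟩
    have hGp : |G * τ * (((X t).2.2.2.2 1 - (X t).2.2.2.1 1)
        + √2 * ((X t).2.2.2.2 0 - (X t).2.2.2.1 0))|
        ≤ |G| * 1 * (3 * (Γ * (V * U) * Real.exp (-c * t))) := by
      rw [abs_mul, abs_mul, abs_of_pos hτ]
      gcongr
    have := (abs_sub _ _).trans (add_le_add k2 hGp)
    rw [add_sub_cancel_right] at this
    exact this.trans (by linarith)
  · have hp := abs_add_sqrt_two_mul_le (n6 0) (n6 1)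
    refine (abs_add_le _ _).trans ?_
    rw [abs_mul, abs_mul, abs_of_pos hτ]
    calc _ ≤ U + |G| * 1 * (3 * (2 * U)) := by gcongr; exact n5 1
      _ ≤ V * U := by
        have : 0 ≤ (2 + D) * U := by positivity
        rw [hV]; linarith
  · intro t ht
    rw [abs_mul]
    calc |G| * |r t| ≤ |G| * (U * Real.exp (-c * t)) := by gcongr; exact hr t ht
      _ = |G| * U * Real.exp (-c * t) := by ring
      _ ≤ _ := by gcongr
  · intro t ht
    refine (abs_fast_input_le (hρ₁.le.trans hρ) hρ' hφ₀ hφ₁).trans ?_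
    rw [← hG, ← hE, mul_assoc E]
    gcongr
    set x₁ := (X t).1 1
    set η₀ := (X t).2.2.2.2 0 - (X t).2.2.2.1 0
    set η₁ := (X t).2.2.2.2 1 - (X t).2.2.2.1 1
    set y₁ := x₁ + G * τ * (η₁ + √2 * η₀)
    have hs := sqrt_two_le_two
    -- The fast input contains `x₁`, not `y₁`; undoing the shift costs only a term with a factor
    -- `τ`, which the small-gain estimate admits.
    have hx₁ : |x₁| ≤ |y₁| + 2 * |G| * (τ * (|η₀| + |η₁|)) := by
      have h1 : |η₁ + √2 * η₀| ≤ 2 * (|η₀| + |η₁|) := by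
        refine (abs_add_le _ _).trans ?_
        rw [abs_mul, abs_of_nonneg (Real.sqrt_nonneg 2)]
        nlinarith [abs_nonneg η₀, abs_nonneg η₁]
      calc |x₁| = |y₁ - G * τ * (η₁ + √2 * η₀)| := by simp only [y₁, add_sub_cancel_right]
        _ ≤ |y₁| + |G| * τ * (2 * (|η₀| + |η₁|)) := by
          refine (abs_sub _ _).trans ?_
          rw [abs_mul, abs_mul, abs_of_pos hτ]
          gcongr
        _ = _ := by ring
    have hU3 : U * Real.exp (-c * t) ≤ V * U * Real.exp (-c * t) := by
      gcongr; linarith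
    have q1 := hr t ht
    have q2 := hd t ht
    have q0 : 0 ≤ U * Real.exp (-c * t) := by positivity
    have q3 : 0 ≤ (1 + 2 * |G|) * (|(X t).1 0| + |y₁| + |(p.plant L).ψ ⬝ᵥ (X t).2.1|) := by
      positivity
    have q4 : 0 ≤ 2 * (τ * (|η₀| + |η₁|)) := by positivity
    have q5 : 0 ≤ 2 * |G| * (V * U * Real.exp (-c * t)) := by positivity
    linarith

/-! ### Robust stability -/

theorem LoopState.norm_le {m n : ℕ} [IsEmpty (Fin n)] {X : LoopState m n} {K : ℝ} (hK : 0 ≤ K)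
    (h0 : ∀ i, |X.1 i| ≤ K) (h1 : ∀ i, |X.2.1 i| ≤ K)
    (h2 : ∀ i, |X.2.2.2.1 i| ≤ K) (h3 : ∀ i, |X.2.2.2.2 i| ≤ K) : ‖X‖ ≤ K := by
  refine norm_prod_le_iff.2 ⟨(pi_norm_le_iff_of_nonneg hK).2 h0, norm_prod_le_iff.2
    ⟨(pi_norm_le_iff_of_nonneg hK).2 h1, norm_prod_le_iff.2
    ⟨(pi_norm_le_iff_of_nonneg hK).2 fun i => isEmptyElim i, norm_prod_le_iff.2
    ⟨(pi_norm_le_iff_of_nonneg hK).2 h2, (pi_norm_le_iff_of_nonneg hK).2 h3⟩⟩⟩⟩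

/-- The loop bound controls `x` and `ζ - ξ`. The remaining states follow in cascade: `z` is a
first-order system driven by `x₀`, `ζ` is the Butterworth filter driven by `η₀ + u_r`, and `ξ = ζ -
η`. -/
theorem exists_exponentiallyStable (p : Actuator) {kp kd : ℝ} (hC : StabilizesNominal p kp kd)
    {Mmin : ℝ} (hM : 0 < Mmin) :
    ∃ τstar : ℝ, 0 < τstar ∧ ∀ τ : ℝ, 0 < τ → τ < τstar → ∀ L : Load, L.AtLeast Mmin →
      ExponentiallyStable (loopField (p.plant L) p.nominal τ kp kd 0 0) := by
  obtain ⟨Γ, τ₀, c₀, hΓ, hτ₀, hτ₀1, hc₀, H⟩ := exists_loop_bound p hC hM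
  obtain ⟨Kf, cf, hKf, hcf, hfilter⟩ :=
    exists_companion_bound 1 1 √2 one_pos le_rfl (by positivity)
  refine ⟨τ₀, hτ₀, fun τ hτ hττ L hL => ?_⟩
  obtain ⟨β, hβ, hz, H⟩ := H L hL
  -- The decay rate depends on the load through `β`, but the threshold on `τ` does not.
  obtain ⟨c, hc, hcc₀, hccf, hcβ⟩ : ∃ c : ℝ, 0 < c ∧ c ≤ c₀ ∧ c ≤ cf ∧ c ≤ β / 2 :=
    ⟨min c₀ (min cf (β / 2)), by positivity, min_le_left _ _,
      (min_le_right _ _).trans (min_le_left _ _), (min_le_right _ _).trans (min_le_right _ _)⟩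
  set Kz : ℝ := 1 + 2 * (|(1 : ℝ)| / β) * Γ with hKz
  set Kζ : ℝ := Kf * (1 + (1 + |kp| + |kd|) * Γ) with hKζ
  refine ⟨Γ + Kz + Kζ, c, by positivity, hc, fun X hX t ht => ?_⟩
  set U : ℝ := ‖X 0‖ with hU
  have hU0 : 0 ≤ U := norm_nonneg _
  have hb := H τ c U hτ hττ hc.le hcc₀ hcβ (fun _ => 0) (fun _ => 0)
    (fun s _ => by simp only [abs_zero]; positivity)
    (fun s _ => by simp only [abs_zero]; positivity) X hX le_rfl
  have hco := fun s (hs : 0 ≤ s) => IsTrajectory.loop_coordinates (N := p.nominal)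
    (r := fun _ => 0) (d := fun _ => 0) hX hs
  have htt : t ∈ Set.Icc 0 t := ⟨ht, le_rfl⟩
  have n2 : ‖(X 0).2‖ ≤ U := norm_snd_le _
  have hzb : ∀ i, |(X t).2.1 i| ≤ Kz * U * Real.exp (-c * t) := by
    intro i
    have h := firstOrder_bound (T := t) (κ := 1) (X := Γ * U) (W := U) hβ hcβ
      (fun s hs => ((hco s hs).2.2.1 i).congr_deriv (by rw [hz, one_mul]))
      ((norm_le_pi_norm _ i).trans ((norm_fst_le _).trans n2)) (by positivity)
      (fun s hs => (hb s hs.1).1) t htt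
    refine h.trans_eq ?_
    rw [hKz]; ring
  have hζ0 : ∀ i, |(X 0).2.2.2.2 i| ≤ U := fun i => (norm_le_pi_norm _ i).trans
    ((norm_snd_le _).trans ((norm_snd_le _).trans ((norm_snd_le _).trans n2)))
  have hζb := hfilter 1 τ c t U ((1 + |kp| + |kd|) * Γ * U) le_rfl le_rfl hτ
    (hττ.le.trans hτ₀1) hc.le hccf hU0 (by positivity) (fun s => (X s).2.2.2.2 0)
    (fun s => (X s).2.2.2.2 1) (fun _ => 0)
    (fun s => ((X s).2.2.2.2 0 - (X s).2.2.2.1 0) + (0 - (kp * (X s).1 0 + kd * (X s).1 1)))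
    (fun s hs => (hco s hs).2.2.2.2.2.1.congr_deriv (by ring))
    (fun s hs => (hco s hs).2.2.2.2.2.2.congr_deriv (by ring)) (hζ0 0) (hζ0 1)
    (fun s _ => by simp only [abs_zero]; positivity)
    (by
      intro s hs
      obtain ⟨b0, b1, b2, -⟩ := hb s hs.1
      rw [zero_sub]
      calc _ ≤ |(X s).2.2.2.2 0 - (X s).2.2.2.1 0| + (|kp| * |(X s).1 0| + |kd| * |(X s).1 1|) := by
            refine (abs_add_le _ _).trans ?_
            rw [abs_neg, ← abs_mul, ← abs_mul]
            gcongr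
            exact abs_add_le _ _
        _ ≤ Γ * U * Real.exp (-c * s) + (|kp| * (Γ * U * Real.exp (-c * s))
            + |kd| * (Γ * U * Real.exp (-c * s))) := by gcongr
        _ = _ := by ring) t htt
  have eζ : Kf * (U + (1 + |kp| + |kd|) * Γ * U) * Real.exp (-c * t)
      = Kζ * (Real.exp (-c * t) * U) := by rw [hKζ]; ring
  rw [eζ] at hζb
  obtain ⟨b0, b1, b2, b3⟩ := hb t ht
  have eU : ∀ k : ℝ, k * U * Real.exp (-c * t) = k * (Real.exp (-c * t) * U) := fun k => by ring
  simp only [eU] at b0 b1 b2 b3 hzb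
  rw [mul_assoc]
  have hW : 0 ≤ Real.exp (-c * t) * U := by positivity
  set W : ℝ := Real.exp (-c * t) * U
  have q1 : 0 ≤ Γ * W := by positivity
  have q2 : 0 ≤ Kz * W := by positivity
  have q3 : 0 ≤ Kζ * W := by positivity
  have hempty : IsEmpty (Fin Load.rigid.zeroDim) := Fin.isEmpty'
  refine LoopState.norm_le (by positivity) ?_ (fun i => (hzb i).trans (by linarith)) ?_ ?_
  · rw [Fin.forall_fin_two]
    exact ⟨b0.trans (by linarith), b1.trans (by linarith)⟩
  · rw [Fin.forall_fin_two]
    constructor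
    · have h := (abs_sub _ _).trans (add_le_add hζb.1 b2)
      rw [sub_sub_cancel] at h
      exact h.trans (by linarith)
    · have h := (abs_sub _ _).trans (add_le_add hζb.2 b3)
      rw [sub_sub_cancel] at h
      exact h.trans (by linarith)
  · rw [Fin.forall_fin_two]
    exact ⟨hζb.1.trans (by linarith), hζb.2.trans (by linarith)⟩

/-! ### Convergence to the nominal loop -/

/-- Coordinates of a trajectory of the nominal loop. -/
theorem IsTrajectory.nominal_coordinates {N : NormalForm 0} {kp kd : ℝ} {r : ℝ → ℝ}
    {Y : ℝ → (Fin 2 → ℝ) × (Fin 0 → ℝ)}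
    (hY : IsTrajectory (fun t => nominalField N kp kd (r t)) Y) {t : ℝ} (ht : 0 ≤ t) :
    HasDerivWithinAt (fun t => (Y t).1 0) ((Y t).1 1) (Set.Ici 0) t ∧
    HasDerivWithinAt (fun t => (Y t).1 1)
      (N.φ 0 * (Y t).1 0 + N.φ 1 * (Y t).1 1
        + N.g * (r t - (kp * (Y t).1 0 + kd * (Y t).1 1))) (Set.Ici 0) t := by
  have h := hY t ht
  simp only [nominalField] at h
  have hy := hasDerivWithinAt_pi.1 h.fst
  refine ⟨hy 0, (hy 1).congr_deriv ?_⟩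
  simp [reference, dotProduct, Fin.sum_univ_two]

/-- Convergence to the nominal loop, with an error proportional to the filter time scale. -/
theorem exists_tracking_bound (p : Actuator) {kp kd : ℝ} (hC : StabilizesNominal p kp kd)
    {Mmin : ℝ} (hM : 0 < Mmin) :
    ∃ Λ τ₀ : ℝ, 0 < Λ ∧ 0 < τ₀ ∧ ∀ τ R : ℝ, 0 < τ → τ < τ₀ → ∀ L : Load, L.AtLeast Mmin →
      ∀ r d : ℝ → ℝ, (∀ t, 0 ≤ t → |r t| ≤ R) → (∀ t, 0 ≤ t → |d t| ≤ R) →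
      ∀ X : ℝ → LoopState L.zeroDim Load.rigid.zeroDim,
        IsTrajectory (fun t => loopField (p.plant L) p.nominal τ kp kd (r t) (d t)) X →
        ‖X 0‖ ≤ R →
      ∀ Y : ℝ → (Fin 2 → ℝ) × (Fin Load.rigid.zeroDim → ℝ),
        IsTrajectory (fun t => nominalField p.nominal kp kd (r t)) Y → (Y 0).1 = (X 0).1 →
      ∀ t, 0 ≤ t → ‖(X t).1 - (Y t).1‖ ≤ Λ * R * τ := by
  obtain ⟨Γ, τ₀, c₀, hΓ, hτ₀, hτ₀1, hc₀, H⟩ := exists_loop_bound p hC hM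
  obtain ⟨ha, hb⟩ := hC.coeff_pos
  have hg := nominal_g_ne_zero p
  set G : ℝ := p.nominal.g with hG
  set b : ℝ := -p.nominal.φ 1 + G * kd with hbdef
  obtain ⟨K, c₁, hK, hc₁, hslow⟩ := exists_companion_bound _ _ b ha le_rfl hb
  set A : ℝ := |G| * (3 * Γ) with hA
  have hGpos : 0 < |G| := abs_pos.2 hg
  have hApos : 0 < A := by positivity
  -- The first summand bounds the error in shifted coordinates; the last `A` accounts for returning
  -- from `y₁` to `x₁`.
  refine ⟨K * (A + (1 + b) * A) + A, τ₀, by positivity, hτ₀, ?_⟩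
  intro τ R hτ hττ L hL r d hr hd X hX hX0 Y hY hY0 t ht
  obtain ⟨β, hβ, -, H⟩ := H L hL
  have hR : 0 ≤ R := (norm_nonneg _).trans hX0
  have hbd := H τ 0 R hτ hττ le_rfl hc₀.le (by positivity) r d (by simpa using hr)
    (by simpa using hd) X hX hX0
  simp only [neg_zero, zero_mul, Real.exp_zero, mul_one] at hbd
  have hx := fun s (hs : 0 ≤ s) => hX.loop_coordinates (N := p.nominal) hs
  have hy := fun s (hs : 0 ≤ s) => hY.nominal_coordinates (N := p.nominal) hs
  have hp : ∀ s, 0 ≤ s → |G * τ * (((X s).2.2.2.2 1 - (X s).2.2.2.1 1)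
      + √2 * ((X s).2.2.2.2 0 - (X s).2.2.2.1 0))| ≤ A * R * τ := by
    intro s hs
    have := abs_add_sqrt_two_mul_le (hbd s hs).2.2.1 (hbd s hs).2.2.2
    rw [abs_mul, abs_mul, abs_of_pos hτ, hA]
    calc _ ≤ |G| * τ * (3 * (Γ * R)) := by gcongr
      _ = _ := by ring
  have hAR : 0 ≤ A * R * τ := by positivity
  -- The slow error system has unit time scale and weight `c = 0`. The reference cancels in the
  -- difference, leaving only the shift as input and as initial error.
  obtain ⟨e0, e1⟩ := hslow _ 1 0 t (A * R * τ) ((1 + b) * (A * R * τ)) le_rfl le_rfl one_pos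
    le_rfl le_rfl hc₁.le hAR (by positivity)
    (fun s => (X s).1 0 - (Y s).1 0)
    (fun s => (X s).1 1 + G * τ * (((X s).2.2.2.2 1 - (X s).2.2.2.1 1)
      + √2 * ((X s).2.2.2.2 0 - (X s).2.2.2.1 0)) - (Y s).1 1)
    (fun s => -(G * τ * (((X s).2.2.2.2 1 - (X s).2.2.2.1 1)
      + √2 * ((X s).2.2.2.2 0 - (X s).2.2.2.1 0))))
    (fun s => b * (G * τ * (((X s).2.2.2.2 1 - (X s).2.2.2.1 1)
      + √2 * ((X s).2.2.2.2 0 - (X s).2.2.2.1 0))))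
    (fun s hs => ((hx s hs).1.sub (hy s hs).1).congr_deriv (by ring))
    (fun s hs => ((hX.hasDerivWithinAt_shifted (N := p.nominal) hτ hg hs).sub
      (hy s hs).2).congr_deriv (by rw [← hG, hbdef]; ring))
    (by rw [hY0, sub_self, abs_zero]; exact hAR)
    (by rw [hY0, add_sub_cancel_left]; exact hp 0 le_rfl)
    (fun s hs => by
      have := hp s hs.1
      have h2 : 0 ≤ b * (A * R * τ) := by positivity
      simp only [neg_zero, zero_mul, Real.exp_zero, mul_one, abs_neg]
      linarith)
    (fun s hs => by
      have := mul_le_mul_of_nonneg_left (hp s hs.1) hb.le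
      simp only [neg_zero, zero_mul, Real.exp_zero, mul_one]
      rw [abs_mul, abs_of_pos hb]
      linarith) t ⟨ht, le_rfl⟩
  simp only [neg_zero, zero_mul, Real.exp_zero, mul_one] at e0 e1
  refine (pi_norm_le_iff_of_nonneg (by positivity)).2 ?_
  rw [Fin.forall_fin_two]
  constructor
  · exact e0.trans (by linarith)
  · have h := (abs_sub _ _).trans (add_le_add e1 (hp t ht))
    rw [show ∀ x q y : ℝ, x + q - y - q = x - y from fun x q y => by ring] at h
    exact h.trans (by linarith)

end DOB

theorem mainTheorem1 (p : DOB.Actuator) (kp kd : ℝ) (hC : DOB.StabilizesNominal p kp kd)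
    (Mmin : ℝ) (hM : 0 < Mmin) :
    (∃ τstar : ℝ, 0 < τstar ∧ ∀ τ : ℝ, 0 < τ → τ < τstar →
      ∀ L : DOB.Load, L.AtLeast Mmin →
        DOB.ExponentiallyStable (DOB.loopField (p.plant L) p.nominal τ kp kd 0 0)) ∧
    (∀ R ε : ℝ, 0 < R → 0 < ε → ∃ τε : ℝ, 0 < τε ∧ ∀ τ : ℝ, 0 < τ → τ < τε →
      ∀ L : DOB.Load, L.AtLeast Mmin →
      ∀ r d : ℝ → ℝ, DOB.AdmissibleSignal R r → DOB.AdmissibleSignal R d →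
      ∀ X : ℝ → DOB.LoopState L.zeroDim DOB.Load.rigid.zeroDim,
        DOB.IsTrajectory
          (fun t => DOB.loopField (p.plant L) p.nominal τ kp kd (r t) (d t)) X →
        ‖X 0‖ ≤ R →
      ∀ Y : ℝ → (Fin 2 → ℝ) × (Fin DOB.Load.rigid.zeroDim → ℝ),
        DOB.IsTrajectory (fun t => DOB.nominalField p.nominal kp kd (r t)) Y →
        Y 0 = ((X 0).1, (X 0).2.2.1) →
      ∀ t, 0 ≤ t → ‖(X t).1 - (Y t).1‖ ≤ ε) := by
  refine ⟨DOB.exists_exponentiallyStable p hC hM, fun R ε hR hε => ?_⟩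
  obtain ⟨Λ, τ₀, hΛ, hτ₀, H⟩ := DOB.exists_tracking_bound p hC hM
  refine ⟨min τ₀ (ε / (Λ * R)), by positivity, ?_⟩
  intro τ hτ hττ L hL r d hr hd X hX hX0 Y hY hY0 t ht
  refine (H τ R hτ (hττ.trans_le (min_le_left _ _)) L hL r d hr.2 hd.2 X hX hX0 Y hY
    (by rw [hY0]) t ht).trans ?_
  have h : τ ≤ ε / (Λ * R) := hττ.le.trans (min_le_right _ _)
  rw [le_div_iff₀ (by positivity)] at h
  linarith
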